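/- Let $n\ge 2$. A (differentiation) basis $B$ in $\mathbb{R}^n$ assigns to each $x\in\mathbb{R}^n$ a family $B(x)$ of bounded Lebesgue measurable sets of positive measure containing $x$, such that some sequence $(R_k)$ in $B(x)$ satisfies $\operatorname{diam} R_k\to 0$. For $f\in L(\mathbb{R}^n)$ let $\overline{D}_B(\int f,x)$ and $\underline{D}_B(\int f,x)$ be the upper and lower limits of $\frac{1}{|R|}\int_R f$ as $R\in B(x)$, $\operatorname{diam} R\to 0$, and for $r\in(0,\infty]$ let $M_B^r(f)(x)=\sup\{\frac{1}{|R|}\int_R|f| : R\in B(x),\ \operatorname{diam} R<r\}$. The basis $B$ is called: translation invariant if $R\in B(x)$ implies $R+v\in B(x+v)$ for all $x,v\in\mathbb{R}^n$; convex if all its sets are convex; a density basis if for every bounded measurable set $E$ one has $\overline{D}_B(\int\chi_E,x)=\underline{D}_B(\int\chi_E,x)=\chi_E(x)$ for almost every $x$; measurable if $\overline{D}_B(\int f,\cdot)$, $\underline{D}_B(\int f,\cdot)$ and $M_B^r(f)$ are Lebesgue measurable for all $f\in L(\mathbb{R}^n)$ and $r\in(0,\infty]$. For measurable bases $B$ and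 $B'$, we say that $B'$ locally majorizes $B$ if there are $c\ge1$ and $\delta>0$ such that $$|\{M_B^r(f)\ge\lambda\}|\le c\,|\{M_{B'}^{cr}(f)\ge\lambda/c\}|$$ for all $f\in L(\mathbb{R}^n)$, $r\in(0,\delta)$ and $\lambda\in(0,\infty)$. The Busemann–Feller extension of $B$ is the basis $B_{\mathrm{BF}}(x)=\{R\in\bigcup_{y\in\mathbb{R}^n}B(y) : x\in R\}$. Theorem 3. If $B$ is a translation invariant convex density basis in $\mathbb{R}^n$, then its Busemann–Feller extension $B_{\mathrm{BF}}$ is also a density basis. Moreover, $B$ and $B_{\mathrm{BF}}$ (which are measurable) locally majorize each other. -/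

import Mathlib

open MeasureTheory Filter Topology
open scoped ENNReal NNReal

/-- A differentiation basis in `ℝⁿ`: to every point `x` is attached a family of bounded (Lebesgue)
measurable sets of positive measure which contain `x`, and this family contains a sequence of sets
whose diameters tend to zero. -/
structure DiffBasis (n : ℕ) where
  /-- the family attached to a point -/
  sets : EuclideanSpace ℝ (Fin n) → Set (Set (EuclideanSpace ℝ (Fin n)))
  isBounded : ∀ x, ∀ R ∈ sets x, Bornology.IsBounded R
  nullMeasurableSet : ∀ x, ∀ R ∈ sets x, NullMeasurableSet R volume
  volume_pos : ∀ x, ∀ R ∈ sets x, 0 < volume R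
  mem : ∀ x, ∀ R ∈ sets x, x ∈ R
  exists_seq : ∀ x, ∃ R : ℕ → Set (EuclideanSpace ℝ (Fin n)),
    (∀ k, R k ∈ sets x) ∧ Tendsto (fun k => Metric.ediam (R k)) atTop (𝓝 0)

namespace DiffBasis

/-- The filter describing "`R ∈ B(x)`, `diam R → 0`". -/
noncomputable def shrink {n : ℕ} (B : DiffBasis n) (x : EuclideanSpace ℝ (Fin n)) :
    Filter (Set (EuclideanSpace ℝ (Fin n))) :=
  comap Metric.ediam (𝓝 0) ⊓ 𝓟 (B.sets x)

/-- The upper derivative at `x` of the integral of `f` with respect to `B`: the upper limit of the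
means `|R|⁻¹ ∫_R f` over `R ∈ B(x)`, `diam R → 0`. -/
noncomputable def upperDeriv {n : ℕ} (B : DiffBasis n) (f : EuclideanSpace ℝ (Fin n) → ℝ)
    (x : EuclideanSpace ℝ (Fin n)) : EReal :=
  limsup (fun R => ((⨍ y in R, f y : ℝ) : EReal)) (B.shrink x)

/-- The lower derivative at `x` of the integral of `f` with respect to `B`. -/
noncomputable def lowerDeriv {n : ℕ} (B : DiffBasis n) (f : EuclideanSpace ℝ (Fin n) → ℝ)
    (x : EuclideanSpace ℝ (Fin n)) : EReal :=
  liminf (fun R => ((⨍ y in R, f y : ℝ) : EReal)) (B.shrink x)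

/-- `B` differentiates the integral of `f`. -/
def Differentiates {n : ℕ} (B : DiffBasis n) (f : EuclideanSpace ℝ (Fin n) → ℝ) : Prop :=
  ∀ᵐ x, B.upperDeriv f x = (f x : EReal) ∧ B.lowerDeriv f x = (f x : EReal)

/-- Density basis: the integral of the indicator function of every bounded measurable set is
differentiated. -/
def IsDensity {n : ℕ} (B : DiffBasis n) : Prop :=
  ∀ E : Set (EuclideanSpace ℝ (Fin n)), Bornology.IsBounded E → NullMeasurableSet E volume →
    B.Differentiates (E.indicator fun _ => (1 : ℝ))

/-- Translation invariance: `R ∈ B(x)` implies `v + R ∈ B(v + x)`. -/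
def IsTranslationInvariant {n : ℕ} (B : DiffBasis n) : Prop :=
  ∀ x, ∀ R ∈ B.sets x, ∀ v : EuclideanSpace ℝ (Fin n), (fun y => v + y) '' R ∈ B.sets (v + x)

/-- Convex basis: all its sets are convex. -/
def IsConvex {n : ℕ} (B : DiffBasis n) : Prop :=
  ∀ x, ∀ R ∈ B.sets x, Convex ℝ R

/-- The truncated maximal operator `M_B^r`, `r ∈ (0, ∞]`. -/
noncomputable def maximal {n : ℕ} (B : DiffBasis n) (r : ℝ≥0∞)
    (f : EuclideanSpace ℝ (Fin n) → ℝ) (x : EuclideanSpace ℝ (Fin n)) : ℝ≥0∞ :=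
  ⨆ R ∈ B.sets x, ⨆ _ : Metric.ediam R < r, (volume R)⁻¹ * ∫⁻ y in R, ‖f y‖ₑ

/-- Measurable basis: for every integrable function, its upper and lower derivatives and its
truncated maximal functions are (Lebesgue) measurable. -/
def IsMeasurable {n : ℕ} (B : DiffBasis n) : Prop :=
  ∀ f : EuclideanSpace ℝ (Fin n) → ℝ, Integrable f volume →
    NullMeasurable (B.upperDeriv f) volume ∧ NullMeasurable (B.lowerDeriv f) volume ∧
      ∀ r : ℝ≥0∞, 0 < r → NullMeasurable (B.maximal r f) volume

/-- `B'.LocallyMajorizes B`: the bases `B` and `B'` are measurable and `B'` locally majorizes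
`B`. -/
def LocallyMajorizes {n : ℕ} (B' B : DiffBasis n) : Prop :=
  B.IsMeasurable ∧ B'.IsMeasurable ∧
    ∃ c δ : ℝ≥0, 1 ≤ c ∧ 0 < δ ∧
      ∀ f : EuclideanSpace ℝ (Fin n) → ℝ, Integrable f volume →
        ∀ r t : ℝ≥0, 0 < r → r < δ → 0 < t →
          volume {x | (t : ℝ≥0∞) ≤ B.maximal r f x} ≤
            c * volume {x | (t : ℝ≥0∞) / c ≤ B'.maximal (c * r) f x}

/-- The Busemann–Feller extension of `B`: at `x` it consists of all the sets of the spread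
`⋃ y, B(y)` that contain `x`. -/
def busemannFeller {n : ℕ} (B : DiffBasis n) : DiffBasis n where
  sets x := {R | R ∈ ⋃ y, B.sets y ∧ x ∈ R}
  isBounded := by
    rintro x R ⟨hR, -⟩
    obtain ⟨y, hy⟩ := Set.mem_iUnion.1 hR
    exact B.isBounded y R hy
  nullMeasurableSet := by
    rintro x R ⟨hR, -⟩
    obtain ⟨y, hy⟩ := Set.mem_iUnion.1 hR
    exact B.nullMeasurableSet y R hy
  volume_pos := by
    rintro x R ⟨hR, -⟩
    obtain ⟨y, hy⟩ := Set.mem_iUnion.1 hR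
    exact B.volume_pos y R hy
  mem := fun _ _ h => h.2
  exists_seq := by
    intro x
    obtain ⟨R, hR, hd⟩ := B.exists_seq x
    exact ⟨R, fun k => ⟨Set.mem_iUnion.2 ⟨x, hR k⟩, B.mem x _ (hR k)⟩, hd⟩

end DiffBasis

/-! Since `B(x)` is contained in the family of the extension at `x`, one majorization is pointwise.
The other, and the density property, rest on a distributional bound for the maximal operator of the
extension (`exists_volume_busemannFeller_maximal_le`).

Its source is a halo bound (`IsDensity.exists_volume_halo_le`): for fixed λ and small diameters, the
points having a set of the basis in which `A` has density above λ fill at most `C |A|`. If this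
failed, translates of bad sets could be assembled into a small set whose upper density is at least λ
on half of a ball.

The halo bound lets pieces be moved. Let `R i ∈ B(0)` have symmetric core `g i + S i`, and let `r i
∈ R i`, chosen freely for each `i`. All pieces `c i + κ S i` can be displaced at once by `± (r i + g
i) / 2`, at the price of halving κ and a factor `C` on the volume of the union: each displaced point
carries a translate of `R i` that catches a fixed proportion of the original piece. Five such moves
compose to `r i - p i + g i`, where also `p i ∈ R i` (`volume_range_le`).

Now let the mean of `|f|` on `y + R` exceed `t/2` and let `x = y + r` with `r ∈ R`. Pigeonhole over
a cover of `R` by at most `N` half cores gives `p ∈ R` such that the maximal function of `B` is at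
least `t/(2N)` on `y + p - g + S/2`. Moving the centre of this piece by `r - p + g` lands exactly on
`x`, so the superlevel set for the extension lies in the set of landing points. Applied to
indicators, the bound gives a halo bound for the extension, hence its density property. -/

section ConvexGeometry

open Metric Set Module
open scoped Pointwise

/-! ### Symmetric cores of convex sets and coverings by them -/

variable {E : Type*} [NormedAddCommGroup E] [NormedSpace ℝ E] [MeasurableSpace E] (μ : Measure E)

/-- A convex set `R` contains a translate `g +ᵥ S` of a symmetric open convex set whose volume is a
definite fraction of that of `R`. -/
structure IsSymmetricCore (R : Set E) (g : E) (S : Set E) : Prop where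
  isOpen : IsOpen S
  convex : Convex ℝ S
  neg_mem : ∀ x ∈ S, -x ∈ S
  zero_mem : (0 : E) ∈ S
  vadd_subset : g +ᵥ S ⊆ R
  measure_le : μ R ≤ 2 ^ (finrank ℝ E + 1) * μ S

variable {μ}

theorem IsSymmetricCore.center_mem {R S : Set E} {g : E} (h : IsSymmetricCore μ R g S) :
    g ∈ R := h.vadd_subset ⟨0, h.zero_mem, by simp⟩

theorem IsSymmetricCore.measure_pos [μ.IsOpenPosMeasure] {R S : Set E} {g : E}
    (h : IsSymmetricCore μ R g S) : 0 < μ S := h.isOpen.measure_pos μ ⟨0, h.zero_mem⟩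

theorem IsSymmetricCore.smul_subset {R S : Set E} {g : E} (h : IsSymmetricCore μ R g S)
    {a b : ℝ} (ha : 0 ≤ a) (hab : a ≤ b) : a • S ⊆ b • S := by
  rintro _ ⟨s, hs, rfl⟩
  rcases ha.eq_or_lt with rfl | ha
  · exact ⟨0, h.zero_mem, by simp⟩
  · have hb : 0 < b := ha.trans_le hab
    refine ⟨(a / b) • s, h.convex.smul_mem_of_zero_mem h.zero_mem hs
      ⟨by positivity, (div_le_one hb).2 hab⟩, ?_⟩
    simp only [smul_smul]
    rw [mul_div_cancel₀ _ hb.ne']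

theorem IsSymmetricCore.half_add_half_mem {R S : Set E} {g : E} (h : IsSymmetricCore μ R g S)
    {c : ℝ} {x y : E} (hx : x ∈ (c / 2) • S) (hy : y ∈ (c / 2) • S) : x + y ∈ c • S := by
  obtain ⟨s, hs, rfl⟩ := hx
  obtain ⟨t, ht, rfl⟩ := hy
  refine ⟨(2⁻¹ : ℝ) • s + (2⁻¹ : ℝ) • t, h.convex hs ht (by norm_num) (by norm_num)
    (by norm_num), ?_⟩
  simp only
  module

variable (μ) [FiniteDimensional ℝ E] [BorelSpace E] [μ.IsAddHaarMeasure]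

theorem lintegral_measure_inter_vadd {A D : Set E} (hA : MeasurableSet A) (hD : MeasurableSet D) :
    ∫⁻ v, μ (A ∩ (v +ᵥ D)) ∂μ = μ A * μ D := by
  have h1 : ∀ v, μ (A ∩ (v +ᵥ D)) =
      ∫⁻ x, A.indicator (fun _ => (1 : ℝ≥0∞)) x * D.indicator (fun _ => (1 : ℝ≥0∞)) (x - v) ∂μ := by
    intro v
    rw [← lintegral_indicator_one (hA.inter (hD.const_vadd v))]
    refine lintegral_congr fun x => ?_
    have : x ∈ v +ᵥ D ↔ x - v ∈ D := by
      rw [mem_vadd_set_iff_neg_vadd_mem, vadd_eq_add, neg_add_eq_sub]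
    by_cases hx : x ∈ A <;> by_cases hy : x - v ∈ D <;>
      simp [indicator, hx, hy, this]
  have hm : Measurable fun p : E × E => A.indicator (fun _ => (1 : ℝ≥0∞)) p.2 *
      D.indicator (fun _ => (1 : ℝ≥0∞)) (p.2 - p.1) :=
    ((measurable_const.indicator hA).comp measurable_snd).mul
      ((measurable_const.indicator hD).comp (measurable_snd.sub measurable_fst))
  simp_rw [h1]
  rw [lintegral_lintegral_swap hm.aemeasurable]
  have h2 : ∀ x, ∫⁻ v, A.indicator (fun _ => (1 : ℝ≥0∞)) x *
      D.indicator (fun _ => (1 : ℝ≥0∞)) (x - v) ∂μ =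
      A.indicator (fun _ => (1 : ℝ≥0∞)) x * μ D := by
    intro x
    rw [lintegral_const_mul _ (show Measurable fun v => D.indicator (fun _ => (1 : ℝ≥0∞)) (x - v)
      from (measurable_const.indicator hD).comp (measurable_const.sub measurable_id)),
      lintegral_sub_left_eq_self (D.indicator fun _ => (1 : ℝ≥0∞)) x]
    simp [hD]
  simp_rw [h2]
  rw [lintegral_mul_const _ (measurable_const.indicator hA)]
  simp [hA]

theorem Convex.measure_interior_eq {R : Set E} (hR : Convex ℝ R) : μ (interior R) = μ R := by
  refine le_antisymm (measure_mono interior_subset) ?_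
  calc μ R ≤ μ (interior R ∪ frontier R) := measure_mono (by
        rw [← closure_eq_interior_union_frontier]; exact subset_closure)
    _ ≤ μ (interior R) + μ (frontier R) := measure_union_le _ _
    _ = μ (interior R) := by rw [hR.addHaar_frontier μ, add_zero]

theorem measure_smul_of_pos (c : ℝ≥0) (S : Set E) :
    μ ((c : ℝ) • S) = (c : ℝ≥0∞) ^ finrank ℝ E * μ S := by
  rw [Measure.addHaar_smul, abs_of_nonneg (by positivity), ENNReal.ofReal_pow (by positivity),
    ENNReal.ofReal_coe_nnreal]

variable {μ}

/-- The overlap of `U = interior R` with its reflection `v - U` integrates to `|U|²` over `v` and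
vanishes off `U + U = 2U`, so some `v` gives an overlap of at least `2⁻ᵏ⁻¹ |U|`. That overlap is
symmetric about `g = v/2`. -/
theorem exists_isSymmetricCore {R : Set E} (hR : Convex ℝ R) (hb : Bornology.IsBounded R)
    (hpos : 0 < μ R) : ∃ g S, IsSymmetricCore μ R g S := by
  set U := interior R with hU
  have hUo : IsOpen U := isOpen_interior
  have hUc : Convex ℝ U := hR.interior
  have hμU : μ U = μ R := hR.measure_interior_eq μ
  have hfin : μ R ≠ ∞ := hb.measure_lt_top.ne
  set k := finrank ℝ E
  obtain ⟨v, hv⟩ : ∃ v, μ U ≤ 2 ^ (k + 1) * μ (U ∩ (v +ᵥ -U)) := by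
    by_contra! hcon
    have hint := lintegral_measure_inter_vadd μ hUo.measurableSet hUo.neg.measurableSet (A := U)
      (D := -U)
    have hsupp : ∀ v, v ∉ (2 : ℝ) • U → μ (U ∩ (v +ᵥ -U)) = 0 := by
      intro v hv
      rw [show U ∩ (v +ᵥ -U) = ∅ from ?_, measure_empty]
      rw [eq_empty_iff_forall_notMem]
      rintro x ⟨hx, y, hy, rfl⟩
      apply hv
      rw [show (2 : ℝ) = 1 + 1 by norm_num, hUc.add_smul zero_le_one zero_le_one, one_smul]
      exact ⟨v +ᵥ y, hx, -y, hy, by simp⟩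
    have hle : ∫⁻ v, μ (U ∩ (v +ᵥ -U)) ∂μ ≤
        ∫⁻ v in (2 : ℝ) • U, (2 ^ (k + 1))⁻¹ * μ U ∂μ := by
      rw [← setLIntegral_eq_of_support_subset (s := (2 : ℝ) • U)]
      · refine lintegral_mono fun v => ?_
        rw [← ENNReal.div_eq_inv_mul, ENNReal.le_div_iff_mul_le (by simp) (by simp), mul_comm]
        exact (hcon v).le
      · intro v hv
        by_contra hcv
        exact hv (hsupp v hcv)
    rw [hint, lintegral_const, Measure.restrict_apply MeasurableSet.univ, univ_inter,
      show ((2 : ℝ)) = ((2 : ℝ≥0) : ℝ) by simp, measure_smul_of_pos, Measure.measure_neg] at hle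
    have h2 : ((2 : ℝ≥0∞) ^ (k + 1))⁻¹ * μ U * (((2 : ℝ≥0) : ℝ≥0∞) ^ k * μ U) =
        (μ U * μ U) / 2 := by
      rw [pow_succ, ENNReal.mul_inv (by simp) (by simp), ENNReal.coe_ofNat, div_eq_mul_inv]
      calc _ = (((2 : ℝ≥0∞) ^ k)⁻¹ * 2 ^ k) * (μ U * μ U * 2⁻¹) := by ring
        _ = _ := by rw [ENNReal.inv_mul_cancel (by simp) (by simp), one_mul]
    rw [h2] at hle
    refine absurd hle (not_le.2 (ENNReal.half_lt_self ?_ ?_))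
    · rw [hμU]; exact mul_ne_zero hpos.ne' hpos.ne'
    · rw [hμU]; exact ENNReal.mul_ne_top hfin hfin
  set g : E := (2⁻¹ : ℝ) • v
  have hgv : g + g = v := by
    rw [← two_smul ℝ, smul_smul]; norm_num
  set S : Set E := {x | g + x ∈ U ∧ g - x ∈ U}
  have hSeq : g +ᵥ S = U ∩ (v +ᵥ -U) := by
    ext x
    constructor
    · rintro ⟨s, hs, rfl⟩
      exact ⟨hs.1, -(g - s), by simpa using hs.2, by simp [← hgv]⟩
    · rintro ⟨hx, y, hy, rfl⟩
      refine ⟨v + y - g, ⟨by simpa using hx, ?_⟩, by simp⟩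
      have : g - (v + y - g) = -y := by rw [← hgv]; abel
      rw [this]; exact hy
  have hSm : μ S = μ (U ∩ (v +ᵥ -U)) := by rw [← hSeq, measure_vadd]
  have hSo : IsOpen S := by
    refine IsOpen.inter (hUo.preimage (by fun_prop : Continuous fun x => g + x))
      (hUo.preimage (by fun_prop : Continuous fun x => g - x))
  have hSc : Convex ℝ S := by
    rintro x ⟨hx1, hx2⟩ y ⟨hy1, hy2⟩ a b ha hb hab
    constructor
    · have := hUc hx1 hy1 ha hb hab
      have h : a • (g + x) + b • (g + y) = g + (a • x + b • y) := by
        calc _ = (a + b) • g + (a • x + b • y) := by module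
          _ = _ := by rw [hab, one_smul]
      rwa [h] at this
    · have := hUc hx2 hy2 ha hb hab
      have h : a • (g - x) + b • (g - y) = g - (a • x + b • y) := by
        calc _ = (a + b) • g - (a • x + b • y) := by module
          _ = _ := by rw [hab, one_smul]
      rwa [h] at this
  have hSneg : ∀ x ∈ S, -x ∈ S := fun x hx => ⟨by simpa [sub_eq_add_neg] using hx.2, by
    simpa using hx.1⟩
  have hSpos : μ S ≠ 0 := by
    intro h0
    rw [← hSm, h0, mul_zero, hμU] at hv
    exact hpos.not_ge hv
  obtain ⟨s, hs⟩ : S.Nonempty := nonempty_of_measure_ne_zero hSpos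
  refine ⟨g, S, hSo, hSc, hSneg, ?_, ?_, ?_⟩
  · have := hSc hs (hSneg s hs) (a := 2⁻¹) (b := 2⁻¹) (by norm_num) (by norm_num) (by norm_num)
    simpa using this
  · rw [hSeq]; exact inter_subset_left.trans interior_subset
  · rw [hSm, ← hμU]; exact hv

/-- A convex set is covered by a bounded number of translates, centred in it, of half of its
symmetric core. -/
theorem IsSymmetricCore.exists_cover {R S : Set E} {g : E} (h : IsSymmetricCore μ R g S)
    (hR : Convex ℝ R) (hb : Bornology.IsBounded R) :
    ∃ t : Finset E, ↑t ⊆ R ∧ t.card ≤ 5 ^ finrank ℝ E * 2 ^ (finrank ℝ E + 1) ∧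
      R ⊆ ⋃ x ∈ t, x +ᵥ (2⁻¹ : ℝ) • S := by
  set k := finrank ℝ E
  set N := 5 ^ k * 2 ^ (k + 1) with hN
  have hg : g ∈ R := h.center_mem
  have hfin : μ R ≠ ∞ := hb.measure_lt_top.ne
  have hSfin : μ S ≠ ∞ := by
    have := measure_mono (μ := μ) h.vadd_subset
    rw [measure_vadd] at this
    exact ne_top_of_le_ne_top hfin this
  have hpack : ∀ t : Finset E, ↑t ⊆ R →
      (t : Set E).PairwiseDisjoint (fun x => x +ᵥ (4⁻¹ : ℝ) • S) → t.card ≤ N := by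
    intro t ht hd
    -- As `g + S ⊆ R`, each `x + S/4` lies in `R + R/4 - g/4`; comparing volumes bounds the number
    -- of disjoint quarter cores by `N`.
    have hsub : (⋃ x ∈ t, x +ᵥ (4⁻¹ : ℝ) • S) ⊆ (-((4⁻¹ : ℝ) • g)) +ᵥ (5 / 4 : ℝ) • R := by
      refine iUnion₂_subset fun x hx => ?_
      rintro _ ⟨_, ⟨s, hs, rfl⟩, rfl⟩
      rw [show (5 / 4 : ℝ) = 1 + 4⁻¹ by norm_num, hR.add_smul zero_le_one (by norm_num), one_smul]
      refine ⟨x + (4⁻¹ : ℝ) • (g + s), ⟨x, ht hx, (4⁻¹ : ℝ) • (g + s),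
        ⟨g + s, h.vadd_subset ⟨s, hs, rfl⟩, rfl⟩, rfl⟩, ?_⟩
      simp only [vadd_eq_add]
      module
    have hm := measure_mono (μ := μ) hsub
    rw [measure_biUnion_finset hd fun x _ =>
      ((h.isOpen.smul₀ (by norm_num)).vadd x).measurableSet] at hm
    simp only [measure_vadd] at hm
    rw [show (4⁻¹ : ℝ) = ((4⁻¹ : ℝ≥0) : ℝ) by simp, show (5 / 4 : ℝ) = ((5 / 4 : ℝ≥0) : ℝ) by simp,
      measure_smul_of_pos, measure_smul_of_pos, Finset.sum_const, nsmul_eq_mul] at hm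
    have h1 : (t.card : ℝ≥0∞) * μ S ≤ 5 ^ k * μ R := by
      have h4 : ((4 : ℝ≥0∞) ^ k) * (((4⁻¹ : ℝ≥0) : ℝ≥0∞) ^ k) = 1 := by
        rw [← mul_pow, ← ENNReal.coe_ofNat, ← ENNReal.coe_mul, mul_inv_cancel₀ (by norm_num)]
        simp
      have h5 : ((4 : ℝ≥0∞) ^ k) * (((5 / 4 : ℝ≥0) : ℝ≥0∞) ^ k) = 5 ^ k := by
        rw [← mul_pow, ← ENNReal.coe_ofNat, ← ENNReal.coe_mul, mul_div_cancel₀ _ (by norm_num)]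
        simp
      calc (t.card : ℝ≥0∞) * μ S
          = ((4 : ℝ≥0∞) ^ k) * (((4⁻¹ : ℝ≥0) : ℝ≥0∞) ^ k) * (t.card * μ S) := by rw [h4, one_mul]
        _ = ((4 : ℝ≥0∞) ^ k) * (t.card * ((((4⁻¹ : ℝ≥0) : ℝ≥0∞) ^ k) * μ S)) := by ring
        _ ≤ ((4 : ℝ≥0∞) ^ k) * ((((5 / 4 : ℝ≥0) : ℝ≥0∞) ^ k) * μ R) := by gcongr
        _ = _ := by rw [← mul_assoc, h5]
    have h2 : (t.card : ℝ≥0∞) * μ S ≤ N * μ S := by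
      refine h1.trans ?_
      calc (5 : ℝ≥0∞) ^ k * μ R ≤ 5 ^ k * (2 ^ (k + 1) * μ S) := by gcongr; exact h.measure_le
        _ = N * μ S := by rw [hN]; push_cast; ring
    rw [ENNReal.mul_le_mul_iff_left h.measure_pos.ne' hSfin] at h2
    exact_mod_cast h2
  by_contra! hcon
  have hex : ∀ m ≤ N + 1, ∃ t : Finset E, ↑t ⊆ R ∧ t.card = m ∧
      (t : Set E).PairwiseDisjoint (fun x => x +ᵥ (4⁻¹ : ℝ) • S) := by
    intro m
    induction m with
    | zero => exact fun _ => ⟨∅, by simp, by simp, by simp⟩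
    | succ m ih =>
      intro hm
      obtain ⟨t, htR, htc, htd⟩ := ih (by omega)
      obtain ⟨x, hxR, hx⟩ := not_subset.1 (hcon t htR (by omega))
      -- Quarter cores that meet have centres differing by an element of `S/2`, so a point left
      -- uncovered by the half cores extends the packing; `N + 1` disjoint quarter cores would
      -- result.
      have hdis : ∀ y ∈ t, Disjoint (x +ᵥ (4⁻¹ : ℝ) • S) (y +ᵥ (4⁻¹ : ℝ) • S) := by
        intro y hy
        rw [Set.disjoint_left]
        rintro _ ⟨_, ⟨s, hs, rfl⟩, rfl⟩ ⟨_, ⟨s', hs', rfl⟩, he⟩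
        refine hx (mem_iUnion₂.2 ⟨y, hy, (4⁻¹ : ℝ) • s' + (4⁻¹ : ℝ) • (-s),
          h.half_add_half_mem ⟨s', hs', by norm_num⟩ ⟨-s, h.neg_mem s hs, by norm_num⟩, ?_⟩)
        simp only [vadd_eq_add] at he ⊢
        rw [← add_assoc, he]
        module
      have hxt : x ∉ t := by
        intro hxt
        have := hdis x hxt
        rw [disjoint_self, bot_eq_empty, eq_empty_iff_forall_notMem] at this
        exact this x ⟨0, ⟨0, h.zero_mem, by simp⟩, by simp⟩
      classical
      refine ⟨insert x t, ?_, by rw [Finset.card_insert_of_notMem hxt, htc], ?_⟩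
      · rw [Finset.coe_insert]; exact insert_subset hxR htR
      · rw [Finset.coe_insert]
        exact htd.insert fun y hy _ => hdis y hy
  obtain ⟨t, htR, htc, htd⟩ := hex (N + 1) le_rfl
  have := hpack t htR htd
  omega

/-! ### Measurability of unions of convex sets, continuity under translation -/

/-- An arbitrary union of convex sets of positive volume is Lebesgue measurable. -/
theorem nullMeasurableSet_sUnion_of_convex (𝒮 : Set (Set E)) (hc : ∀ R ∈ 𝒮, Convex ℝ R)
    (hpos : ∀ R ∈ 𝒮, 0 < μ R) : NullMeasurableSet (⋃₀ 𝒮) μ := by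
  set U := ⋃ R ∈ 𝒮, interior R
  have hUo : IsOpen U := isOpen_biUnion fun _ _ => isOpen_interior
  have hUs : U ⊆ ⋃₀ 𝒮 := iUnion₂_subset fun R hR => interior_subset.trans (subset_sUnion_of_mem hR)
  have hdens : ∀ᵐ x ∂μ.restrict Uᶜ, ∀ K : ℕ, ∀ (w : ℕ → E) (δ : ℕ → ℝ)
      (_ : Tendsto δ atTop (𝓝[>] 0)) (_ : ∀ᶠ j in atTop, x ∈ closedBall (w j) (K * δ j)),
      Tendsto (fun j => μ (Uᶜ ∩ closedBall (w j) (δ j)) / μ (closedBall (w j) (δ j))) atTop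
        (𝓝 1) := by
    rw [ae_all_iff]
    intro K
    filter_upwards [IsUnifLocDoublingMeasure.ae_tendsto_measure_inter_div μ Uᶜ (K : ℝ)] with x hx
    exact fun w δ => hx w δ
  -- A point `x ∈ R` outside `U` is not a density point of `Uᶜ`: contracting a ball of `interior R`
  -- towards `x` yields balls inside `U` whose distance to `x` is comparable to their radius. The
  -- density theorem for such off-centre balls makes these points null.
  have hnull : μ (⋃₀ 𝒮 \ U) = 0 := by
    rw [ae_restrict_iff' hUo.isClosed_compl.measurableSet] at hdens
    refine measure_mono_null ?_ (ae_iff.1 hdens)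
    rintro x ⟨⟨R, hR, hxR⟩, hxU⟩ hx
    have hint : (interior R).Nonempty := by
      apply nonempty_of_measure_ne_zero (μ := μ)
      rw [(hc R hR).measure_interior_eq μ]
      exact (hpos R hR).ne'
    obtain ⟨y, hy⟩ := hint
    obtain ⟨ρ, hρ, hball⟩ := nhds_basis_closedBall.mem_iff.1 (isOpen_interior.mem_nhds hy)
    obtain ⟨K, hK⟩ := exists_nat_ge (dist x y / ρ)
    have hKρ : dist x y ≤ K * ρ := (div_le_iff₀ hρ).1 hK
    set τ : ℕ → ℝ := fun j => 1 / ((j : ℝ) + 1)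
    have hτpos : ∀ j, 0 < τ j := fun j => by positivity
    have hτ1 : ∀ j, τ j ≤ 1 := fun j => by
      rw [div_le_one (by positivity)]; linarith [(Nat.cast_nonneg j : (0 : ℝ) ≤ j)]
    have hτ0 : Tendsto τ atTop (𝓝 0) := tendsto_one_div_add_atTop_nhds_zero_nat
    have hlim := hx hxU K (fun j => x + τ j • (y - x)) (fun j => τ j * ρ) (by
      refine tendsto_nhdsWithin_iff.2 ⟨by simpa using hτ0.mul_const ρ, .of_forall fun j => ?_⟩
      exact mul_pos (hτpos j) hρ) (.of_forall fun j => by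
        rw [mem_closedBall, dist_eq_norm, show x - (x + τ j • (y - x)) = τ j • (x - y) by module,
          norm_smul, Real.norm_of_nonneg (hτpos j).le, ← dist_eq_norm]
        calc τ j * dist x y ≤ τ j * (K * ρ) := by gcongr
          _ = K * (τ j * ρ) := by ring)
    have hzero : ∀ j, μ (Uᶜ ∩ closedBall (x + τ j • (y - x)) (τ j * ρ)) = 0 := by
      intro j
      rw [show Uᶜ ∩ closedBall (x + τ j • (y - x)) (τ j * ρ) = ∅ from ?_, measure_empty]
      rw [eq_empty_iff_forall_notMem]
      rintro z ⟨hzU, hz⟩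
      refine hzU (mem_iUnion₂.2 ⟨R, hR, ?_⟩)
      have hz' : y + (τ j)⁻¹ • (z - (x + τ j • (y - x))) ∈ interior R := by
        apply hball
        rw [mem_closedBall, dist_eq_norm, add_sub_cancel_left, norm_smul, norm_inv,
          Real.norm_of_nonneg (hτpos j).le, inv_mul_le_iff₀ (hτpos j), ← dist_eq_norm]
        exact hz
      have := (hc R hR).add_smul_sub_mem_interior hxR hz' ⟨hτpos j, hτ1 j⟩
      convert this using 1
      rw [smul_sub (τ j), smul_add (τ j), smul_smul, mul_inv_cancel₀ (hτpos j).ne']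
      module
    simp only [hzero, ENNReal.zero_div] at hlim
    exact zero_ne_one (tendsto_nhds_unique tendsto_const_nhds hlim)
  have : ⋃₀ 𝒮 = U ∪ (⋃₀ 𝒮 \ U) := (union_sdiff_cancel hUs).symm
  rw [this]
  exact hUo.measurableSet.nullMeasurableSet.union (NullMeasurableSet.of_null hnull)

/-- Dominated convergence: the boundary of a convex set is null, and off the translated boundary the
indicator is locally constant in `v`. -/
theorem Convex.continuous_setIntegral_vadd {R : Set E} (hR : Convex ℝ R) {f : E → ℝ}
    (hf : Integrable f μ) : Continuous fun v : E => ∫ y in v +ᵥ R, f y ∂μ := by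
  have hconv : ∀ v : E, Convex ℝ (v +ᵥ R) := fun v => hR.vadd v
  have hnm : ∀ v : E, NullMeasurableSet (v +ᵥ R) μ := fun v => (hconv v).nullMeasurableSet μ
  simp_rw [← integral_indicator₀ (hnm _)]
  refine continuous_iff_continuousAt.2 fun x => ?_
  refine continuousAt_of_dominated (bound := fun y => ‖f y‖)
    (.of_forall fun v => hf.aestronglyMeasurable.indicator₀ (hnm v))
    (.of_forall fun v => .of_forall fun y => norm_indicator_le_norm_self _ _) hf.norm ?_
  have hnull : μ (x +ᵥ frontier R) = 0 := by rw [measure_vadd, hR.addHaar_frontier μ]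
  filter_upwards [measure_eq_zero_iff_ae_notMem.1 hnull] with y hy
  have hmem : ∀ v : E, y ∈ v +ᵥ R ↔ y - v ∈ R := fun v => by
    rw [mem_vadd_set_iff_neg_vadd_mem, vadd_eq_add, neg_add_eq_sub]
  have hcont : Continuous fun v : E => y - v := by fun_prop
  have hyR : y - x ∉ frontier R := fun h => hy (by
    rwa [mem_vadd_set_iff_neg_vadd_mem, vadd_eq_add, neg_add_eq_sub])
  by_cases hin : y - x ∈ closure R
  · have hint : y - x ∈ interior R := by
      by_contra h
      exact hyR ⟨hin, h⟩
    refine ContinuousAt.congr (f := fun _ => f y) continuousAt_const ?_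
    filter_upwards [hcont.continuousAt.preimage_mem_nhds (isOpen_interior.mem_nhds hint)] with v hv
    rw [indicator_of_mem ((hmem v).2 (interior_subset hv))]
  · refine ContinuousAt.congr (f := fun _ => (0 : ℝ)) continuousAt_const ?_
    filter_upwards [hcont.continuousAt.preimage_mem_nhds
      (isClosed_closure.isOpen_compl.mem_nhds hin)] with v hv
    rw [indicator_of_notMem fun h => hv (subset_closure ((hmem v).1 h))]

theorem Convex.continuous_setLIntegral_enorm_vadd {R : Set E} (hR : Convex ℝ R) {f : E → ℝ}
    (hf : Integrable f μ) : Continuous fun v : E => ∫⁻ y in v +ᵥ R, ‖f y‖ₑ ∂μ := by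
  have h : ∀ v : E, ∫⁻ y in v +ᵥ R, ‖f y‖ₑ ∂μ = ENNReal.ofReal (∫ y in v +ᵥ R, ‖f y‖ ∂μ) :=
    fun v => (ofReal_integral_norm_eq_lintegral_enorm hf.restrict).symm
  simp_rw [h]
  exact ENNReal.continuous_ofReal.comp (hR.continuous_setIntegral_vadd hf.norm)

theorem Convex.continuous_measure_vadd_inter {R : Set E} (hR : Convex ℝ R) {A : Set E}
    (hA : MeasurableSet A) (hfin : μ A ≠ ∞) : Continuous fun v : E => μ ((v +ᵥ R) ∩ A) := by
  have h := hR.continuous_setLIntegral_enorm_vadd (μ := μ) (f := A.indicator fun _ => (1 : ℝ))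
    ((integrable_indicator_iff hA).2 (integrableOn_const hfin))
  refine h.congr fun v => ?_
  simp_rw [enorm_indicator_eq_indicator_enorm, enorm_one]
  rw [lintegral_indicator_const hA, Measure.restrict_apply hA, one_mul, inter_comm]

/-! ### Covering half of a ball by few translates -/

/-- A measurable set of positive measure inside a unit ball has boundedly many (relative to its
measure) translates which cover half of the unit ball around the origin. -/
theorem exists_translates_cover_half_ball {D : Set E} (hD : MeasurableSet D) {z : E}
    (hDz : D ⊆ ball z 1) (hpos : 0 < μ D) :
    ∃ s : Finset E, s.card * μ D ≤ 3 * μ (ball 0 2) ∧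
      μ (ball 0 1) / 2 ≤ μ (ball 0 1 ∩ ⋃ v ∈ s, v +ᵥ D) := by
  set u := μ (ball (0 : E) 1) with hu
  set τ := μ (ball (0 : E) 2) with hτ
  set d := μ D
  have hu0 : u ≠ 0 := (measure_ball_pos μ _ one_pos).ne'
  have huT : u ≠ ∞ := measure_ball_lt_top.ne
  have hτ0 : τ ≠ 0 := (measure_ball_pos μ _ two_pos).ne'
  have hτT : τ ≠ ∞ := measure_ball_lt_top.ne
  have hdu : d ≤ u := (measure_mono hDz).trans_eq (Measure.addHaar_ball_center μ z 1)
  have hdτ : d ≤ τ := hdu.trans (measure_mono (ball_subset_ball one_le_two))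
  have hdT : d ≠ ∞ := ne_top_of_le_ne_top huT hdu
  have hmeas : ∀ s : Finset E, MeasurableSet (⋃ v ∈ s, v +ᵥ D) := fun s =>
    Finset.measurableSet_biUnion _ fun v _ => hD.const_vadd v
  -- The overlaps `|W ∩ (v + D)|` integrate to `|W| |D|` and vanish for `v` outside a ball of radius
  -- 2, so some `v` reaches the average.
  have hstep : ∀ W ⊆ ball (0 : E) 1, MeasurableSet W → ∃ v : E, μ W * d ≤ τ * μ (W ∩ (v +ᵥ D)) := by
    intro W hW hWm
    have hsupp : Function.support (fun v => μ (W ∩ (v +ᵥ D))) ⊆ ball (-z) 2 := by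
      intro v hv
      obtain ⟨_, hx, y, hy, rfl⟩ := nonempty_of_measure_ne_zero hv
      have h1 := hW hx
      have h2 := hDz hy
      rw [mem_ball_iff_norm] at h1 h2 ⊢
      simp only [vadd_eq_add, sub_zero] at h1
      calc ‖v - -z‖ = ‖(v + y) - (y - z)‖ := by congr 1; abel
        _ ≤ ‖v + y‖ + ‖y - z‖ := norm_sub_le _ _
        _ < 2 := by linarith
    have hint : ∫⁻ v in ball (-z) 2, μ (W ∩ (v +ᵥ D)) ∂μ = μ W * d := by
      rw [setLIntegral_eq_of_support_subset hsupp, lintegral_measure_inter_vadd μ hWm hD]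
    have hball : μ (ball (-z) 2) = τ := Measure.addHaar_ball_center μ _ _
    obtain ⟨v, -, hv⟩ := exists_setLAverage_le (μ := μ) (s := ball (-z) 2)
      (f := fun v => μ (W ∩ (v +ᵥ D))) (by rwa [hball]) measurableSet_ball.nullMeasurableSet (by
        rw [hint]
        exact ENNReal.mul_ne_top (ne_top_of_le_ne_top huT (measure_mono hW)) hdT)
    refine ⟨v, ?_⟩
    rw [setLAverage_eq, hint, hball, ENNReal.div_le_iff hτ0 hτT, mul_comm _ τ] at hv
    exact hv
  -- Greedy choice: while less than half of the ball is covered, the remainder has measure at least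
  -- `u/2`, and one more translate covers at least `u d / (2τ)` of it.
  have hind : ∀ m : ℕ, ∃ s : Finset E, s.card ≤ m ∧
      (u / 2 ≤ μ (ball 0 1 ∩ ⋃ v ∈ s, v +ᵥ D) ∨
        m * (u * d) ≤ 2 * τ * μ (ball 0 1 ∩ ⋃ v ∈ s, v +ᵥ D)) := by
    intro m
    induction m with
    | zero => exact ⟨∅, by simp, Or.inr (by simp)⟩
    | succ m ih =>
      obtain ⟨s, hs, hcase⟩ := ih
      rcases le_or_gt (u / 2) (μ (ball 0 1 ∩ ⋃ v ∈ s, v +ᵥ D)) with hle | hlt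
      · exact ⟨s, by omega, Or.inl hle⟩
      have hm := hcase.resolve_left (not_le.2 hlt)
      set W := ball (0 : E) 1 \ ⋃ v ∈ s, v +ᵥ D
      have hWm : MeasurableSet W := measurableSet_ball.diff (hmeas s)
      have hsum : μ (ball 0 1 ∩ ⋃ v ∈ s, v +ᵥ D) + μ W = u := measure_inter_add_sdiff _ (hmeas s)
      have hWu : u / 2 ≤ μ W := by
        by_contra! h
        have := ENNReal.add_lt_add hlt h
        rw [hsum, ENNReal.add_halves] at this
        exact this.ne rfl
      obtain ⟨v, hv⟩ := hstep W sdiff_subset hWm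
      classical
      refine ⟨insert v s, (Finset.card_insert_le _ _).trans (by omega), Or.inr ?_⟩
      have hdisj : Disjoint (ball 0 1 ∩ ⋃ v ∈ s, v +ᵥ D) (W ∩ (v +ᵥ D)) := by
        rw [Set.disjoint_left]
        exact fun x hx hx' => hx'.1.2 hx.2
      have hnew : μ (ball 0 1 ∩ ⋃ v ∈ s, v +ᵥ D) + μ (W ∩ (v +ᵥ D)) ≤
          μ (ball 0 1 ∩ ⋃ w ∈ insert v s, w +ᵥ D) := by
        rw [← measure_union hdisj (hWm.inter (hD.const_vadd v)), Finset.set_biUnion_insert]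
        refine measure_mono (union_subset (inter_subset_inter_right _ subset_union_right) ?_)
        exact fun x hx => ⟨hx.1.1, Or.inl hx.2⟩
      calc ((m + 1 : ℕ) : ℝ≥0∞) * (u * d) = m * (u * d) + 2 * (u / 2 * d) := by
            push_cast
            rw [← mul_assoc 2, ENNReal.mul_div_cancel (by simp) (by simp)]; ring
        _ ≤ 2 * τ * μ (ball 0 1 ∩ ⋃ v ∈ s, v +ᵥ D) + 2 * (τ * μ (W ∩ (v +ᵥ D))) := by
            refine add_le_add hm (mul_le_mul' le_rfl (le_trans ?_ hv))
            gcongr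
        _ = 2 * τ * (μ (ball 0 1 ∩ ⋃ v ∈ s, v +ᵥ D) + μ (W ∩ (v +ᵥ D))) := by ring
        _ ≤ _ := by gcongr
  have hqT : 2 * τ / d ≠ ∞ := ENNReal.div_ne_top (ENNReal.mul_ne_top (by simp) hτT) hpos.ne'
  set m := ⌊(2 * τ / d).toReal⌋₊ + 1
  have hm1 : 2 * τ < m * d := by
    rw [← ENNReal.div_lt_iff (Or.inl hpos.ne') (Or.inl hdT), ← ENNReal.ofReal_toReal hqT,
      ← ENNReal.ofReal_natCast, ENNReal.ofReal_lt_ofReal_iff (by positivity)]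
    push_cast [m]
    exact Nat.lt_floor_add_one _
  have hm2 : m * d ≤ 3 * τ := by
    have : ((⌊(2 * τ / d).toReal⌋₊ : ℕ) : ℝ≥0∞) ≤ 2 * τ / d := by
      rw [← ENNReal.ofReal_toReal hqT, ← ENNReal.ofReal_natCast]
      rw [ENNReal.toReal_ofReal ENNReal.toReal_nonneg]
      exact ENNReal.ofReal_le_ofReal (Nat.floor_le ENNReal.toReal_nonneg)
    calc (m : ℝ≥0∞) * d = (⌊(2 * τ / d).toReal⌋₊ : ℕ) * d + d := by push_cast [m]; ring
      _ ≤ 2 * τ / d * d + τ := by gcongr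
      _ = 2 * τ + τ := by rw [ENNReal.div_mul_cancel hpos.ne' hdT]
      _ = 3 * τ := by ring
  obtain ⟨s, hs, hcase⟩ := hind m
  refine ⟨s, le_trans (by gcongr) hm2, hcase.resolve_right fun h => ?_⟩
  have h' : m * d * u ≤ 2 * τ * u := by
    calc m * d * u = m * (u * d) := by ring
      _ ≤ _ := h
      _ ≤ 2 * τ * u := by gcongr; exact measure_mono inter_subset_left
  rw [ENNReal.mul_le_mul_iff_left hu0 huT] at h'
  exact hm1.not_ge h'

end ConvexGeometry

/-! ### Halos, and the halo bound forced by the density property -/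

namespace DiffBasis

open Metric Set Module
open scoped Pointwise

variable {n : ℕ} {B : DiffBasis n}

theorem IsTranslationInvariant.vadd_mem (hT : B.IsTranslationInvariant)
    {x : EuclideanSpace ℝ (Fin n)} {R : Set (EuclideanSpace ℝ (Fin n))} (hR : R ∈ B.sets x)
    (v : EuclideanSpace ℝ (Fin n)) : v +ᵥ R ∈ B.sets (v + x) := hT x R hR v

theorem ediam_vadd (v : EuclideanSpace ℝ (Fin n)) (R : Set (EuclideanSpace ℝ (Fin n))) :
    ediam (v +ᵥ R) = ediam R := (isometry_vadd (EuclideanSpace ℝ (Fin n)) v).ediam_image R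

theorem volume_ne_top {x : EuclideanSpace ℝ (Fin n)} {R : Set (EuclideanSpace ℝ (Fin n))}
    (hR : R ∈ B.sets x) : volume R ≠ ∞ := (B.isBounded x R hR).measure_lt_top.ne

theorem hasBasis_shrink (B : DiffBasis n) (x : EuclideanSpace ℝ (Fin n)) :
    (B.shrink x).HasBasis (fun ε : ℝ≥0∞ => 0 < ε) fun ε => {R | R ∈ B.sets x ∧ ediam R < ε} := by
  refine ((ENNReal.nhds_zero_basis.comap ediam).inf_principal (B.sets x)).to_hasBasis
    (fun ε hε => ⟨ε, hε, fun R hR => ⟨hR.2, hR.1⟩⟩) fun ε hε => ⟨ε, hε, fun R hR => ⟨hR.2, hR.1⟩⟩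

instance neBot_shrink (B : DiffBasis n) (x : EuclideanSpace ℝ (Fin n)) : (B.shrink x).NeBot := by
  refine (B.hasBasis_shrink x).neBot_iff.2 fun {ε} hε => ?_
  obtain ⟨R, hR, hlim⟩ := B.exists_seq x
  obtain ⟨k, hk⟩ := (hlim.eventually (gt_mem_nhds hε)).exists
  exact ⟨R k, hR k, hk⟩

theorem setAverage_indicator_one {G R : Set (EuclideanSpace ℝ (Fin n))}
    (hG : NullMeasurableSet G volume) :
    ⨍ y in R, G.indicator (fun _ => (1 : ℝ)) y = volume.real (R ∩ G) / volume.real R := by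
  have hG' : NullMeasurableSet G (volume.restrict R) :=
    hG.mono_ac Measure.absolutelyContinuous_restrict
  rw [setAverage_eq, integral_indicator₀ hG', setIntegral_const, smul_eq_mul, smul_eq_mul, mul_one,
    measureReal_def, measureReal_def, Measure.restrict_apply₀ hG', inter_comm, measureReal_def,
    inv_mul_eq_div]

/-- The set of points `x` having a set `R ∈ B(x)` of diameter less than `δ` in which the relative
measure of `A` exceeds `lam`. -/
def halo (B : DiffBasis n) (δ : ℝ≥0∞) (lam : ℝ≥0) (A : Set (EuclideanSpace ℝ (Fin n))) :
    Set (EuclideanSpace ℝ (Fin n)) :=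
  {x | ∃ R ∈ B.sets x, ediam R < δ ∧ lam * volume R < volume (R ∩ A)}

theorem halo_mono {δ δ' : ℝ≥0∞} {lam lam' : ℝ≥0} {A A' : Set (EuclideanSpace ℝ (Fin n))}
    (hδ : δ ≤ δ') (hlam : lam' ≤ lam) (hA : A ⊆ A') : B.halo δ lam A ⊆ B.halo δ' lam' A' := by
  rintro x ⟨R, hR, hd, hlt⟩
  refine ⟨R, hR, hd.trans_le hδ, lt_of_le_of_lt ?_ (hlt.trans_le (measure_mono
    (inter_subset_inter_right _ hA)))⟩
  gcongr

/-- Let a witness `R` follow the point by translation: its volume stays fixed and its overlap with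
`A` varies continuously. -/
theorem isOpen_halo (hT : B.IsTranslationInvariant) (hC : B.IsConvex) (δ : ℝ≥0∞) (lam : ℝ≥0)
    {A : Set (EuclideanSpace ℝ (Fin n))} (hA : MeasurableSet A) (hfin : volume A ≠ ∞) :
    IsOpen (B.halo δ lam A) := by
  refine isOpen_iff_mem_nhds.2 ?_
  rintro x ⟨R, hR, hd, hlt⟩
  have hcont := (hC x R hR).continuous_measure_vadd_inter (μ := volume) hA hfin
  have hcont' : Continuous fun y => volume (((y - x) +ᵥ R) ∩ A) :=
    hcont.comp (continuous_sub_right x)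
  have hx : lam * volume R < volume (((x - x) +ᵥ R) ∩ A) := by simpa using hlt
  filter_upwards [hcont'.continuousAt.eventually (lt_mem_nhds hx)] with y hy
  refine ⟨(y - x) +ᵥ R, by simpa using hT.vadd_mem hR (y - x), by rwa [ediam_vadd], ?_⟩
  rwa [measure_vadd]

theorem halo_vadd (hT : B.IsTranslationInvariant) (δ : ℝ≥0∞) (lam : ℝ≥0)
    (A : Set (EuclideanSpace ℝ (Fin n))) (v : EuclideanSpace ℝ (Fin n)) :
    v +ᵥ B.halo δ lam A ⊆ B.halo δ lam (v +ᵥ A) := by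
  rintro _ ⟨x, ⟨R, hR, hd, hlt⟩, rfl⟩
  refine ⟨v +ᵥ R, hT.vadd_mem hR v, by rwa [ediam_vadd], ?_⟩
  rwa [← vadd_set_inter, measure_vadd, measure_vadd]

theorem subset_ball_of_ediam_lt {x : EuclideanSpace ℝ (Fin n)}
    {R : Set (EuclideanSpace ℝ (Fin n))} (hx : x ∈ R) {r : ℝ} (hd : ediam R < ENNReal.ofReal r) :
    R ⊆ ball x r := by
  intro y hy
  have := (edist_le_ediam_of_mem hy hx).trans_lt hd
  rw [edist_dist] at this
  exact (ENNReal.ofReal_lt_ofReal_iff_of_nonneg dist_nonneg).1 this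

theorem halo_inter_ball_subset {δ : ℝ≥0∞} (hδ : δ ≤ 1) (lam : ℝ≥0)
    (A : Set (EuclideanSpace ℝ (Fin n))) (z : EuclideanSpace ℝ (Fin n)) :
    B.halo δ lam A ∩ ball z 1 ⊆ B.halo δ lam (A ∩ ball z 2) := by
  rintro x ⟨⟨R, hR, hd, hlt⟩, hx⟩
  refine ⟨R, hR, hd, hlt.trans_le (measure_mono fun y hy => ⟨hy.1, hy.2, ?_⟩)⟩
  have h1 := subset_ball_of_ediam_lt (B.mem x R hR) (r := 1) (by
    simpa using hd.trans_le hδ) hy.1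
  rw [mem_ball] at h1 hx ⊢
  linarith [dist_triangle y x z]

/-- Integrating the opposite inequality over all centres `z` would give the global bound; `2 ^ n` is
the ratio of the volumes of the two balls. -/
theorem exists_local_halo_gt (hT : B.IsTranslationInvariant) (hC : B.IsConvex) {δ : ℝ≥0∞}
    {lam C : ℝ≥0} {A : Set (EuclideanSpace ℝ (Fin n))} (hA : MeasurableSet A)
    (hfin : volume A ≠ ∞) (hlt : (C * 2 ^ n : ℝ≥0∞) * volume A < volume (B.halo δ lam A)) :
    ∃ z, C * volume (A ∩ ball z 2) < volume (B.halo δ lam A ∩ ball z 1) := by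
  by_contra! hcon
  have hv : ∀ (z : EuclideanSpace ℝ (Fin n)) (r : ℝ),
      ball z r = z +ᵥ ball (0 : EuclideanSpace ℝ (Fin n)) r := by
    intro z r; rw [vadd_ball, vadd_eq_add, add_zero]
  have h1 := lintegral_measure_inter_vadd volume (isOpen_halo hT hC δ lam hA hfin).measurableSet
    (measurableSet_ball (x := (0 : EuclideanSpace ℝ (Fin n))) (ε := 1))
  have h2 := lintegral_measure_inter_vadd volume hA
    (measurableSet_ball (x := (0 : EuclideanSpace ℝ (Fin n))) (ε := 2))
  have hb : volume (ball (0 : EuclideanSpace ℝ (Fin n)) 2) =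
      2 ^ n * volume (ball (0 : EuclideanSpace ℝ (Fin n)) 1) := by
    have := Measure.addHaar_ball_mul_of_pos volume (0 : EuclideanSpace ℝ (Fin n)) two_pos 1
    rw [mul_one] at this
    rw [this, finrank_euclideanSpace_fin, ENNReal.ofReal_pow (by norm_num)]
    norm_num
  have hle : volume (B.halo δ lam A) * volume (ball (0 : EuclideanSpace ℝ (Fin n)) 1) ≤
      (C * 2 ^ n) * volume A * volume (ball (0 : EuclideanSpace ℝ (Fin n)) 1) := by
    calc _ ≤ C * (volume A * volume (ball (0 : EuclideanSpace ℝ (Fin n)) 2)) := by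
          rw [← h1, ← h2, ← lintegral_const_mul' _ _ (by simp)]
          refine lintegral_mono fun z => ?_
          simpa only [← hv] using hcon z
      _ = _ := by rw [hb]; ring
  rw [ENNReal.mul_le_mul_iff_left (measure_ball_pos _ _ one_pos).ne' measure_ball_lt_top.ne] at hle
  exact hlt.not_ge hle

/-- Localize a bad set to a ball, then translate it until the translated halos fill half of the unit
ball. The number of translates is controlled by the measure of the local halo, which exceeds `C`
times that of the localized set, so a large `C` makes the union small. -/
theorem exists_small_set_large_halo (hT : B.IsTranslationInvariant) (hC : B.IsConvex)
    {lam : ℝ≥0} {δ : ℝ≥0∞} (hδ : δ ≤ 1)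
    (hcon : ∀ C : ℝ≥0, ∃ A, MeasurableSet A ∧ C * volume A < volume (B.halo δ lam A))
    {ε : ℝ≥0} (hε : 0 < ε) : ∃ G, MeasurableSet G ∧ volume G ≤ ε ∧
      volume (ball (0 : EuclideanSpace ℝ (Fin n)) 1) / 2 ≤
        volume (ball 0 1 ∩ B.halo δ lam G) := by
  set τ := volume (ball (0 : EuclideanSpace ℝ (Fin n)) 2)
  have hτT : τ ≠ ∞ := measure_ball_lt_top.ne
  set C : ℝ≥0 := 3 * τ.toNNReal / ε + 1
  have hC0 : 0 < C := by positivity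
  have hCε : 3 * τ ≤ C * ε := by
    rw [← ENNReal.coe_toNNReal hτT]
    norm_cast
    rw [add_mul, div_mul_cancel₀ _ hε.ne']
    exact le_self_add
  obtain ⟨A, hA, hlt⟩ := hcon (C * 2 ^ n)
  have hfin : volume A ≠ ∞ := by
    intro h
    rw [h, ENNReal.mul_top (by simp [hC0.ne'])] at hlt
    exact not_top_lt hlt
  obtain ⟨z, hz⟩ := exists_local_halo_gt hT hC hA hfin (C := C) (by exact_mod_cast hlt)
  set D := B.halo δ lam A ∩ ball z 1
  have hDm : MeasurableSet D := (isOpen_halo hT hC δ lam hA hfin).measurableSet.inter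
    measurableSet_ball
  obtain ⟨s, hs, hcov⟩ := exists_translates_cover_half_ball hDm inter_subset_right
    (pos_of_gt hz)
  have hA1 : MeasurableSet (A ∩ ball z 2) := hA.inter measurableSet_ball
  refine ⟨⋃ v ∈ s, v +ᵥ (A ∩ ball z 2), Finset.measurableSet_biUnion _ fun v _ =>
    hA1.const_vadd v, ?_, hcov.trans (measure_mono (inter_subset_inter_right _ ?_))⟩
  · have h1 : volume (⋃ v ∈ s, v +ᵥ (A ∩ ball z 2)) ≤ s.card * volume (A ∩ ball z 2) := by
      refine (measure_biUnion_finset_le _ _).trans_eq ?_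
      simp [measure_vadd]
    have h2 : C * volume (⋃ v ∈ s, v +ᵥ (A ∩ ball z 2)) ≤ C * ε := by
      calc _ ≤ C * (s.card * volume (A ∩ ball z 2)) := by gcongr
        _ = s.card * (C * volume (A ∩ ball z 2)) := by ring
        _ ≤ s.card * volume D := by gcongr
        _ ≤ 3 * τ := hs
        _ ≤ _ := hCε
    rwa [ENNReal.mul_le_mul_iff_right (by simpa using hC0.ne') (by simp)] at h2
  · refine iUnion₂_subset fun v hv => ?_
    calc v +ᵥ D ⊆ v +ᵥ B.halo δ lam (A ∩ ball z 2) :=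
          vadd_set_mono (halo_inter_ball_subset hδ lam A z)
      _ ⊆ B.halo δ lam (v +ᵥ (A ∩ ball z 2)) := halo_vadd hT _ _ _ _
      _ ⊆ _ := halo_mono le_rfl le_rfl (subset_biUnion_of_mem (u := fun v => v +ᵥ (A ∩ ball z 2)) hv)

theorem le_upperDeriv_of_forall_mem_halo {lam : ℝ≥0} {A : Set (EuclideanSpace ℝ (Fin n))}
    (hA : NullMeasurableSet A volume) {x : EuclideanSpace ℝ (Fin n)}
    (h : ∀ ε > 0, x ∈ B.halo ε lam A) :
    ((lam : ℝ) : EReal) ≤ B.upperDeriv (A.indicator fun _ => 1) x := by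
  refine le_limsup_of_frequently_le ?_ (by isBoundedDefault)
  refine (B.hasBasis_shrink x).frequently_iff.2 fun {ε} hε => ?_
  obtain ⟨R, hR, hd, hlt⟩ := h ε hε
  refine ⟨R, ⟨hR, hd⟩, ?_⟩
  rw [setAverage_indicator_one hA, EReal.coe_le_coe_iff, measureReal_def, measureReal_def,
    le_div_iff₀ (ENNReal.toReal_pos
    (B.volume_pos x R hR).ne' (volume_ne_top hR))]
  have := ENNReal.toReal_mono (ne_top_of_le_ne_top (volume_ne_top hR)
    (measure_mono inter_subset_left)) hlt.le
  rwa [ENNReal.toReal_mul, ENNReal.coe_toReal] at this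

/-- The halo estimate for translation invariant convex density bases. -/
theorem IsDensity.exists_volume_halo_le (hD : B.IsDensity) (hT : B.IsTranslationInvariant)
    (hC : B.IsConvex) {lam : ℝ≥0} (hlam : 0 < lam) :
    ∃ C δ : ℝ≥0, 0 < δ ∧ ∀ A, MeasurableSet A → volume (B.halo δ lam A) ≤ C * volume A := by
  by_contra! hcon
  set u := volume (ball (0 : EuclideanSpace ℝ (Fin n)) 1)
  have hu0 : u ≠ 0 := (measure_ball_pos _ _ one_pos).ne'
  have huT : u ≠ ∞ := measure_ball_lt_top.ne
  obtain ⟨ε, hεpos, hεsum⟩ := ENNReal.exists_pos_sum_of_countable (ENNReal.half_pos hu0).ne' ℕ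
  set δ : ℕ → ℝ≥0 := fun k => 1 / ((k : ℝ≥0) + 1)
  have hδpos : ∀ k, 0 < δ k := fun k => by positivity
  have hδ1 : ∀ k, (δ k : ℝ≥0∞) ≤ 1 := fun k => by
    rw [← ENNReal.coe_one, ENNReal.coe_le_coe]
    exact div_le_one_of_le₀ le_add_self zero_le
  have hδanti : Antitone δ := fun i j hij => by
    simp only [δ]
    gcongr
  have hδ0 : Tendsto δ atTop (𝓝 0) := tendsto_one_div_add_atTop_nhds_zero_nat (𝕜 := ℝ≥0)
  choose G hGm hGε hGu using fun k => exists_small_set_large_halo hT hC (hδ1 k)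
    (fun C => hcon C (δ k) (hδpos k)) (hεpos k)
  -- One bounded set serves all scales `δ k`: its measure is below `u/2`, yet at each scale its halo
  -- fills at least `u/2` of the unit ball.
  set A := (⋃ k, G k) ∩ ball 0 2
  have hAm : MeasurableSet A := (MeasurableSet.iUnion hGm).inter measurableSet_ball
  have hAlt : volume A < u / 2 := calc
    volume A ≤ volume (⋃ k, G k) := measure_mono inter_subset_left
    _ ≤ ∑' k, volume (G k) := measure_iUnion_le _
    _ ≤ ∑' k, (ε k : ℝ≥0∞) := ENNReal.tsum_le_tsum hGε
    _ < u / 2 := hεsum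
  have hAT : volume A ≠ ∞ := (hAlt.trans_le le_top).ne
  set H : ℕ → Set (EuclideanSpace ℝ (Fin n)) := fun k => ball 0 1 ∩ B.halo (δ k) lam A
  have hHm : ∀ k, MeasurableSet (H k) := fun k =>
    measurableSet_ball.inter (isOpen_halo hT hC _ _ hAm hAT).measurableSet
  have hHu : ∀ k, u / 2 ≤ volume (H k) := by
    intro k
    refine (hGu k).trans (measure_mono fun x hx => ⟨hx.1, ?_⟩)
    exact halo_mono le_rfl le_rfl (inter_subset_inter_left _ (subset_iUnion G k))
      (halo_inter_ball_subset (hδ1 k) lam (G k) 0 ⟨hx.2, hx.1⟩)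
  have hHanti : Antitone H := fun i j hij => inter_subset_inter_right _
    (halo_mono (by exact_mod_cast hδanti hij) le_rfl subset_rfl)
  have hlim : u / 2 ≤ volume (⋂ k, H k) := by
    rw [hHanti.measure_iInter (fun k => (hHm k).nullMeasurableSet)
      ⟨0, ne_top_of_le_ne_top huT (measure_mono inter_subset_left)⟩]
    exact le_iInf hHu
  have hdiff := hD A (isBounded_ball.subset inter_subset_right) hAm.nullMeasurableSet
  -- A point in the halos of all scales has upper density at least `lam > 0`, so by the density
  -- property it lies in `A` almost surely; but `⋂ k, H k` is larger than `A`.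
  have hae : (⋂ k, H k) ≤ᵐ[volume] A := by
    filter_upwards [hdiff] with x hx
    intro (hxH : x ∈ ⋂ k, H k)
    by_contra hxA
    replace hxA : x ∉ A := hxA
    have hle := le_upperDeriv_of_forall_mem_halo (lam := lam) (B := B) hAm.nullMeasurableSet (x := x)
      (fun η hη => by
        have h1 : Tendsto (fun k => (δ k : ℝ≥0∞)) atTop (𝓝 0) := by
          rw [← ENNReal.coe_zero]; exact ENNReal.tendsto_coe.2 hδ0
        obtain ⟨k, hk⟩ := (h1.eventually (gt_mem_nhds hη)).exists
        exact halo_mono hk.le le_rfl subset_rfl (mem_iInter.1 hxH k).2)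
    rw [hx.1, indicator_of_notMem hxA, EReal.coe_le_coe_iff] at hle
    exact hle.not_gt (by exact_mod_cast hlam)
  exact (hlim.trans (measure_mono_ae hae)).not_gt hAlt
-- Displacing pieces of a union by means of the halo bound
section Shift

variable {δ : ℝ≥0∞} {lam C : ℝ≥0} {ι : Type*} {R S : ι → Set (EuclideanSpace ℝ (Fin n))}
  {g : ι → EuclideanSpace ℝ (Fin n)}

/-- Every point of the displaced union lies in the halo of the original one. By convexity `R i`
contains `(r i + g i)/2 + S i / 2`, so the translate of `R i` attached to the point contains a copy
of `(κ/2) S i` inside `c i + κ S i`; `hκ` says that this proportion of `R i` exceeds `lam`. -/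
theorem volume_iUnion_sub_le (hT : B.IsTranslationInvariant) (hC : B.IsConvex)
    (hhalo : ∀ A, MeasurableSet A → volume (B.halo δ lam A) ≤ C * volume A)
    (hR : ∀ i, R i ∈ B.sets 0) (hRδ : ∀ i, ediam (R i) < δ)
    (hS : ∀ i, IsSymmetricCore volume (R i) (g i) (S i)) {κ : ℝ≥0} (hκ0 : 0 < κ) (hκ1 : κ ≤ 1)
    (hκ : lam * 2 ^ (n + 1) < (κ / 2) ^ n) (c r : ι → EuclideanSpace ℝ (Fin n))
    (hr : ∀ i, r i ∈ R i) :
    volume (⋃ i, (c i - (2⁻¹ : ℝ) • (r i + g i)) +ᵥ (((κ / 2 : ℝ≥0) : ℝ) • S i)) ≤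
      C * volume (⋃ i, c i +ᵥ ((κ : ℝ) • S i)) := by
  have hU : IsOpen (⋃ i, c i +ᵥ ((κ : ℝ) • S i)) := isOpen_iUnion fun i =>
    ((hS i).isOpen.smul₀ (by simpa using hκ0.ne')).vadd _
  refine le_trans (measure_mono (iUnion_subset fun i => ?_)) (hhalo _ hU.measurableSet)
  rintro _ ⟨s, hs, rfl⟩
  have hκ2 : ((κ / 2 : ℝ≥0) : ℝ) = (κ : ℝ) / 2 := by push_cast; rfl
  set x := c i - (2⁻¹ : ℝ) • (r i + g i) + s
  have hmem : x +ᵥ R i ∈ B.sets x := by simpa using hT.vadd_mem (hR i) x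
  refine ⟨x +ᵥ R i, hmem, by rw [ediam_vadd]; exact hRδ i, ?_⟩
  have hsub : (c i + s) +ᵥ (((κ / 2 : ℝ≥0) : ℝ) • S i) ⊆
      (x +ᵥ R i) ∩ ⋃ i, c i +ᵥ ((κ : ℝ) • S i) := by
    rintro _ ⟨y, hy, rfl⟩
    refine ⟨?_, mem_iUnion.2 ⟨i, s + y, ?_, by simp [add_assoc]⟩⟩
    · obtain ⟨z, hz, hzy⟩ := (hS i).smul_subset (by positivity) (b := 2⁻¹) (by
        rw [hκ2]; have : (κ : ℝ) ≤ 1 := hκ1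
        linarith) hy
      refine ⟨(2⁻¹ : ℝ) • r i + (2⁻¹ : ℝ) • (g i + z), hC 0 _ (hR i) (hr i)
        ((hS i).vadd_subset ⟨z, hz, rfl⟩) (by norm_num) (by norm_num) (by norm_num), ?_⟩
      simp only at hzy
      simp only [vadd_eq_add, ← hzy, x]
      module
    · rw [hκ2] at hs hy
      exact (hS i).half_add_half_mem hs hy
  refine lt_of_lt_of_le ?_ (measure_mono hsub)
  rw [measure_vadd, measure_vadd, measure_smul_of_pos, finrank_euclideanSpace_fin]
  have hSfin : volume (S i) ≠ ∞ := by
    have := measure_mono (μ := volume) (hS i).vadd_subset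
    rw [measure_vadd] at this
    exact ne_top_of_le_ne_top (volume_ne_top (hR i)) this
  calc lam * volume (R i) ≤ lam * (2 ^ (n + 1) * volume (S i)) := by
        have := (hS i).measure_le
        rw [finrank_euclideanSpace_fin] at this
        gcongr
    _ = ((lam * 2 ^ (n + 1) : ℝ≥0) : ℝ≥0∞) * volume (S i) := by push_cast; ring
    _ < (((κ / 2) ^ n : ℝ≥0) : ℝ≥0∞) * volume (S i) :=
        ENNReal.mul_lt_mul_left (hS i).measure_pos.ne' hSfin (by exact_mod_cast hκ)
    _ = _ := by push_cast; rfl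

theorem _root_.IsSymmetricCore.neg_vadd_smul {R S : Set (EuclideanSpace ℝ (Fin n))}
    {g : EuclideanSpace ℝ (Fin n)} (h : IsSymmetricCore volume R g S)
    (c : EuclideanSpace ℝ (Fin n)) (a : ℝ) : -(c +ᵥ (a • S)) = -c +ᵥ (a • S) := by
  ext x
  constructor
  · rintro ⟨_, ⟨s, hs, rfl⟩, hx⟩
    refine ⟨a • (-s), ⟨-s, h.neg_mem s hs, rfl⟩, ?_⟩
    simp only [vadd_eq_add] at hx ⊢
    rw [← neg_neg x, ← hx]
    module
  · rintro ⟨_, ⟨s, hs, rfl⟩, rfl⟩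
    refine ⟨a • (-s), ⟨-s, h.neg_mem s hs, rfl⟩, ?_⟩
    simp only [vadd_eq_add]
    module

/-- Reflection through the origin reverses the displacement and preserves volume and the symmetric
cores; the basis itself need not be symmetric. -/
theorem volume_iUnion_add_le (hT : B.IsTranslationInvariant) (hC : B.IsConvex)
    (hhalo : ∀ A, MeasurableSet A → volume (B.halo δ lam A) ≤ C * volume A)
    (hR : ∀ i, R i ∈ B.sets 0) (hRδ : ∀ i, ediam (R i) < δ)
    (hS : ∀ i, IsSymmetricCore volume (R i) (g i) (S i)) {κ : ℝ≥0} (hκ0 : 0 < κ) (hκ1 : κ ≤ 1)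
    (hκ : lam * 2 ^ (n + 1) < (κ / 2) ^ n) (c r : ι → EuclideanSpace ℝ (Fin n))
    (hr : ∀ i, r i ∈ R i) :
    volume (⋃ i, (c i + (2⁻¹ : ℝ) • (r i + g i)) +ᵥ (((κ / 2 : ℝ≥0) : ℝ) • S i)) ≤
      C * volume (⋃ i, c i +ᵥ ((κ : ℝ) • S i)) := by
  have h := volume_iUnion_sub_le hT hC hhalo hR hRδ hS hκ0 hκ1 hκ (fun i => -c i) r hr
  rw [← Measure.measure_neg volume, ← Measure.measure_neg volume (⋃ i, -c i +ᵥ ((κ : ℝ) • S i)),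
    iUnion_neg, iUnion_neg] at h
  simp_rw [fun i => (hS i).neg_vadd_smul] at h
  simpa [sub_eq_add_neg, add_comm] using h

/-- Translating each piece of a union by a difference of points of the set it comes from does not
increase the volume of the union by more than a constant factor. -/
theorem volume_range_le (hT : B.IsTranslationInvariant) (hC : B.IsConvex)
    (hhalo : ∀ A, MeasurableSet A → volume (B.halo δ lam A) ≤ C * volume A)
    (hlam : lam * 2 ^ (n + 1) < 64⁻¹ ^ n)
    (hR : ∀ i, R i ∈ B.sets 0) (hRδ : ∀ i, ediam (R i) < δ)
    (hS : ∀ i, IsSymmetricCore volume (R i) (g i) (S i)) (c p r : ι → EuclideanSpace ℝ (Fin n))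
    (hp : ∀ i, p i ∈ R i) (hr : ∀ i, r i ∈ R i) :
    volume (range fun i => c i + r i - p i + g i) ≤
      C ^ 5 * volume (⋃ i, c i +ᵥ ((2⁻¹ : ℝ) • S i)) := by
  have hg : ∀ i, g i ∈ R i := fun i => (hS i).center_mem
  have hκ : ∀ κ : ℝ≥0, 64⁻¹ ≤ κ / 2 → lam * 2 ^ (n + 1) < (κ / 2) ^ n := fun κ h =>
    hlam.trans_le (by gcongr)
  have aux : ∀ a b : ℕ, a ≤ b → (2⁻¹ : ℝ≥0) ^ b ≤ 2⁻¹ ^ a := fun a b h =>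
    pow_le_pow_of_le_one zero_le (by
      rw [inv_le_one₀ two_pos]; exact one_le_two) h
  have e64 : (64⁻¹ : ℝ≥0) = 2⁻¹ ^ 6 := by rw [inv_pow]; norm_num
  have ediv : ∀ a : ℕ, (2⁻¹ : ℝ≥0) ^ a / 2 = 2⁻¹ ^ (a + 1) := fun a => by
    rw [pow_succ, div_eq_mul_inv]
  have hκ' : ∀ a : ℕ, a ≤ 5 → lam * 2 ^ (n + 1) < ((2⁻¹ : ℝ≥0) ^ a / 2) ^ n := fun a ha =>
    hκ _ (by rw [e64, ediv]; exact aux _ _ (by omega))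
  have hpos : ∀ a : ℕ, (0 : ℝ≥0) < 2⁻¹ ^ a := fun a => by positivity
  have hle : ∀ a : ℕ, (2⁻¹ : ℝ≥0) ^ a ≤ 1 := fun a => by simpa using aux 0 a (Nat.zero_le _)
  have hsub := fun (a : ℕ) (ha : a ≤ 5) =>
    volume_iUnion_sub_le hT hC hhalo hR hRδ hS (hpos a) (hle a) (hκ' a ha)
  have hadd := fun (a : ℕ) (ha : a ≤ 5) =>
    volume_iUnion_add_le hT hC hhalo hR hRδ hS (hpos a) (hle a) (hκ' a ha)
  simp only [ediv] at hsub hadd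
  -- Two moves by `-(p + g)/2` and two by `(r + g)/2` add up to `r - p`; a fifth, with the point `g`
  -- itself, adds `g`. Meanwhile κ runs from `1/2` to `1/32`, leaving pieces of size `1/64`, of
  -- which only the centres are kept.
  set c₁ := fun i => c i - (2⁻¹ : ℝ) • (p i + g i) with hc₁
  set c₂ := fun i => c₁ i - (2⁻¹ : ℝ) • (p i + g i) with hc₂
  set c₃ := fun i => c₂ i + (2⁻¹ : ℝ) • (r i + g i) with hc₃
  set c₄ := fun i => c₃ i + (2⁻¹ : ℝ) • (r i + g i) with hc₄
  have h1 := hsub 1 (by norm_num) c p hp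
  have h2 := hsub 2 (by norm_num) c₁ p hp
  have h3 := hadd 3 (by norm_num) c₂ r hr
  have h4 := hadd 4 (by norm_num) c₃ r hr
  have h5 := hadd 5 (by norm_num) c₄ g hg
  have h := h5.trans (mul_le_mul' le_rfl (h4.trans (mul_le_mul' le_rfl (h3.trans
    (mul_le_mul' le_rfl (h2.trans (mul_le_mul' le_rfl h1)))))))
  refine le_trans (measure_mono ?_) (h.trans_eq ?_)
  · rintro _ ⟨i, rfl⟩
    refine mem_iUnion.2 ⟨i, 0, ⟨0, (hS i).zero_mem, by simp⟩, ?_⟩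
    simp only [vadd_eq_add, hc₁, hc₂, hc₃, hc₄]
    module
  · rw [pow_one, NNReal.coe_inv, NNReal.coe_ofNat]
    ring

end Shift

/-! ### Comparison of the maximal operators -/

theorem maximal_mono (B : DiffBasis n) {r r' : ℝ≥0∞} (h : r ≤ r')
    (f : EuclideanSpace ℝ (Fin n) → ℝ) (x : EuclideanSpace ℝ (Fin n)) :
    B.maximal r f x ≤ B.maximal r' f x :=
  iSup₂_mono fun _ _ => iSup_mono' fun hd => ⟨hd.trans_le h, le_rfl⟩

theorem mem_busemannFeller {x : EuclideanSpace ℝ (Fin n)} {R : Set (EuclideanSpace ℝ (Fin n))} :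
    R ∈ B.busemannFeller.sets x ↔ (∃ y, R ∈ B.sets y) ∧ x ∈ R := by
  simp [busemannFeller]

theorem maximal_le_busemannFeller (r : ℝ≥0∞) (f : EuclideanSpace ℝ (Fin n) → ℝ)
    (x : EuclideanSpace ℝ (Fin n)) : B.maximal r f x ≤ B.busemannFeller.maximal r f x :=
  biSup_mono fun R hR => mem_busemannFeller.2 ⟨⟨x, hR⟩, B.mem x R hR⟩

theorem lt_maximal_iff {r a : ℝ≥0∞} {f : EuclideanSpace ℝ (Fin n) → ℝ}
    {x : EuclideanSpace ℝ (Fin n)} : a < B.maximal r f x ↔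
      ∃ R ∈ B.sets x, ediam R < r ∧ a * volume R < ∫⁻ y in R, ‖f y‖ₑ := by
  simp only [maximal, lt_iSup_iff, exists_prop]
  refine exists_congr fun R => and_congr_right fun hR => and_congr_right fun _ => ?_
  rw [← ENNReal.div_eq_inv_mul, ENNReal.lt_div_iff_mul_lt (Or.inl (B.volume_pos x R hR).ne')
    (Or.inl (volume_ne_top hR))]

/-- If the mean of `f` over `b +ᵥ R` is large, then so is the maximal function of `f` on some
translate of half of the symmetric core of `R`. -/
theorem exists_maximal_ge_on_core (hT : B.IsTranslationInvariant) (hC : B.IsConvex)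
    {R S : Set (EuclideanSpace ℝ (Fin n))} {g : EuclideanSpace ℝ (Fin n)} (hR : R ∈ B.sets 0)
    (hS : IsSymmetricCore volume R g S) {r : ℝ≥0∞} (hr : ediam R < r)
    {f : EuclideanSpace ℝ (Fin n) → ℝ} {b : EuclideanSpace ℝ (Fin n)} {t : ℝ≥0∞}
    (ht : t * volume R < ∫⁻ y in b +ᵥ R, ‖f y‖ₑ) :
    ∃ p ∈ R, (b + p - g) +ᵥ ((2⁻¹ : ℝ) • S) ⊆
      {x | t / (5 ^ n * 2 ^ (n + 1) : ℕ) ≤ B.maximal r f x} := by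
  obtain ⟨T, hTR, hcard, hcov⟩ := hS.exists_cover (hC 0 R hR) (B.isBounded 0 R hR)
  rw [finrank_euclideanSpace_fin] at hcard
  set N := 5 ^ n * 2 ^ (n + 1) with hN
  have hN0 : (N : ℝ≥0∞) ≠ 0 := by simp [hN]
  obtain ⟨p, hp, hlarge⟩ : ∃ p ∈ T, t / N * volume R <
      ∫⁻ y in (b + p) +ᵥ ((2⁻¹ : ℝ) • S), ‖f y‖ₑ := by
    by_contra! hcon
    refine ht.not_ge ?_
    calc ∫⁻ y in b +ᵥ R, ‖f y‖ₑ
        ≤ ∫⁻ y in ⋃ p ∈ T, (b + p) +ᵥ ((2⁻¹ : ℝ) • S), ‖f y‖ₑ := by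
          refine lintegral_mono_set ?_
          rintro _ ⟨y, hy, rfl⟩
          obtain ⟨p, hp, z, hz, rfl⟩ := mem_iUnion₂.1 (hcov hy)
          exact mem_iUnion₂.2 ⟨p, hp, z, hz, by simp [add_assoc]⟩
      _ ≤ ∑ p ∈ T, ∫⁻ y in (b + p) +ᵥ ((2⁻¹ : ℝ) • S), ‖f y‖ₑ := by
          rw [← T.tsum_subtype fun p => ∫⁻ y in (b + p) +ᵥ ((2⁻¹ : ℝ) • S), ‖f y‖ₑ]
          rw [← Finset.set_biUnion_coe, biUnion_eq_iUnion]
          exact lintegral_iUnion_le (fun p : T => (b + (p : EuclideanSpace ℝ (Fin n))) +ᵥ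
            ((2⁻¹ : ℝ) • S)) _
      _ ≤ T.card • (t / N * volume R) := Finset.sum_le_card_nsmul _ _ _ hcon
      _ ≤ N * (t / N * volume R) := by rw [nsmul_eq_mul]; gcongr
      _ = t * volume R := by rw [← mul_assoc, ENNReal.mul_div_cancel hN0 (by simp)]
  refine ⟨p, hTR hp, ?_⟩
  rintro _ ⟨s, hs, rfl⟩
  -- The translate of `R` by this point contains `b + p + s + S`, hence all of `b + p + S/2`,
  -- because `s ∈ S/2` and `S` is symmetric and convex.
  refine (lt_maximal_iff.2 ⟨(b + p - g + s) +ᵥ R, ?_, by rwa [ediam_vadd], ?_⟩).le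
  · simpa using hT.vadd_mem hR (b + p - g + s)
  · rw [measure_vadd]
    refine hlarge.trans_le (lintegral_mono_set ?_)
    rintro _ ⟨y, hy, rfl⟩
    obtain ⟨s, hs, rfl⟩ := hs
    have hms : (2⁻¹ : ℝ) • (-s) ∈ (2⁻¹ : ℝ) • S := ⟨-s, hS.neg_mem s hs, rfl⟩
    have hz : y + (2⁻¹ : ℝ) • (-s) ∈ (1 : ℝ) • S :=
      hS.half_add_half_mem (c := 1) (by simpa using hy) (by simpa using hms)
    rw [one_smul] at hz
    refine ⟨g + (y + (2⁻¹ : ℝ) • (-s)), hS.vadd_subset ⟨_, hz, rfl⟩, ?_⟩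
    simp only [vadd_eq_add]
    module

theorem exists_volume_busemannFeller_maximal_le (hD : B.IsDensity) (hT : B.IsTranslationInvariant)
    (hC : B.IsConvex) : ∃ C δ : ℝ≥0, 0 < δ ∧ ∀ (f : EuclideanSpace ℝ (Fin n) → ℝ) (r t : ℝ≥0),
      r ≤ δ → 0 < t → volume {x | (t : ℝ≥0∞) ≤ B.busemannFeller.maximal r f x} ≤
        C * volume {x | (t : ℝ≥0∞) / 2 / (5 ^ n * 2 ^ (n + 1) : ℕ) ≤ B.maximal r f x} := by
  -- The threshold is set by the smallest pieces, of scale `1/64`, against the volume ratio `2 ^ (n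
  -- + 1)` of the core; the last factor `1/2` makes the inequality strict.
  set lam : ℝ≥0 := 64⁻¹ ^ n / 2 ^ (n + 1) / 2
  have hlam0 : 0 < lam := by positivity
  have hlam : lam * 2 ^ (n + 1) < 64⁻¹ ^ n := by
    have : lam * 2 ^ (n + 1) = 64⁻¹ ^ n / 2 := by
      simp only [lam]; field_simp
    rw [this]
    exact NNReal.half_lt_self (by positivity)
  obtain ⟨C, δ, hδ, hhalo⟩ := hD.exists_volume_halo_le hT hC hlam0
  refine ⟨C ^ 5, δ, hδ, fun f r t hr ht => ?_⟩
  -- An index `(R, b, r)` records a set normalized to `B(0)`, its position and a point of it, so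
  -- that `b + r` is a point of `b + R`. The level `t/2` instead of `t` ensures that the supremum is
  -- exceeded by an actual set.
  let ι := {q : Set (EuclideanSpace ℝ (Fin n)) × EuclideanSpace ℝ (Fin n) ×
    EuclideanSpace ℝ (Fin n) // q.1 ∈ B.sets 0 ∧ ediam q.1 < r ∧ q.2.2 ∈ q.1 ∧
      (t : ℝ≥0∞) / 2 * volume q.1 < ∫⁻ y in q.2.1 +ᵥ q.1, ‖f y‖ₑ}
  choose g S hS using fun i : ι => exists_isSymmetricCore (μ := volume) (hC 0 _ i.2.1)
    (B.isBounded 0 _ i.2.1) (B.volume_pos 0 _ i.2.1)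
  choose p hp hpS using fun i : ι =>
    exists_maximal_ge_on_core hT hC i.2.1 (hS i) i.2.2.1 i.2.2.2.2
  have hmain := volume_range_le hT hC hhalo hlam (R := fun i : ι => i.1.1) (fun i => i.2.1)
    (fun i => i.2.2.1.trans_le (by exact_mod_cast hr)) hS
    (fun i => i.1.2.1 + p i - g i) p (fun i => i.1.2.2) hp (fun i => i.2.2.2.1)
  refine le_trans (measure_mono ?_) (hmain.trans ?_)
  · intro x hx
    have hlt : (t : ℝ≥0∞) / 2 < B.busemannFeller.maximal r f x :=
      (ENNReal.half_lt_self (by simpa using ht.ne') (by simp)).trans_le hx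
    obtain ⟨R, hR, hRr, hRt⟩ := lt_maximal_iff.1 hlt
    obtain ⟨⟨y, hRy⟩, hxR⟩ := mem_busemannFeller.1 hR
    refine ⟨⟨(-y +ᵥ R, y, x - y), by simpa using hT.vadd_mem hRy (-y), by
      simpa only [ediam_vadd] using hRr, ⟨x, hxR, by simp [sub_eq_neg_add]⟩, ?_⟩, ?_⟩
    · simpa only [measure_vadd, vadd_neg_vadd] using hRt
    · simp only
      abel
  · push_cast
    gcongr
    exact iUnion_subset fun i => by simpa using hpS i
-- Measurability of both bases
section Measurability

variable {α : Type*} [CompleteLinearOrder α] [TopologicalSpace α] [OrderTopology α]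
  [SecondCountableTopology α] [MeasurableSpace α] [BorelSpace α]

theorem nullMeasurable_of_Ioi {h : EuclideanSpace ℝ (Fin n) → α}
    (hh : ∀ a, NullMeasurableSet {x | a < h x} volume) : NullMeasurable h volume :=
  measurable_of_Ioi (δ := NullMeasurableSpace (EuclideanSpace ℝ (Fin n)) volume) hh

/-- The function is lower semicontinuous: a set exceeding the level at `x` can be translated along
to nearby points. -/
theorem nullMeasurable_iSup_of_continuous (hT : B.IsTranslationInvariant)
    {φ : Set (EuclideanSpace ℝ (Fin n)) → α}
    (hφ : ∀ x, ∀ R ∈ B.sets x, Continuous fun v : EuclideanSpace ℝ (Fin n) => φ (v +ᵥ R))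
    (r : ℝ≥0∞) : NullMeasurable (fun x => ⨆ R ∈ B.sets x, ⨆ _ : ediam R < r, φ R) volume := by
  refine nullMeasurable_of_Ioi fun a => (IsOpen.measurableSet ?_).nullMeasurableSet
  refine isOpen_iff_mem_nhds.2 fun x hx => ?_
  simp only [mem_ofPred_eq, lt_iSup_iff] at hx
  obtain ⟨R, hR, hd, hlt⟩ := hx
  have hcont : Continuous fun y => φ ((y - x) +ᵥ R) := (hφ x R hR).comp (continuous_sub_right x)
  have hx : a < φ ((x - x) +ᵥ R) := by simpa using hlt
  filter_upwards [hcont.continuousAt.eventually (lt_mem_nhds hx)] with y hy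
  simp only [lt_iSup_iff]
  exact ⟨(y - x) +ᵥ R, by simpa using hT.vadd_mem hR (y - x), by rwa [ediam_vadd], hy⟩

/-- In the extension a set is attached to all its points, so each strict superlevel set is a union
of convex sets of positive volume. -/
theorem nullMeasurable_iSup_busemannFeller (hC : B.IsConvex)
    (φ : Set (EuclideanSpace ℝ (Fin n)) → α) (r : ℝ≥0∞) :
    NullMeasurable (fun x => ⨆ R ∈ B.busemannFeller.sets x, ⨆ _ : ediam R < r, φ R) volume := by
  refine nullMeasurable_of_Ioi fun a => ?_
  have : {x | a < ⨆ R ∈ B.busemannFeller.sets x, ⨆ _ : ediam R < r, φ R} =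
      ⋃₀ {R | (∃ y, R ∈ B.sets y) ∧ ediam R < r ∧ a < φ R} := by
    ext x
    simp only [mem_ofPred_eq, lt_iSup_iff, mem_busemannFeller, mem_sUnion, exists_prop]
    exact exists_congr fun R => by tauto
  rw [this]
  exact nullMeasurableSet_sUnion_of_convex _ (fun R ⟨⟨y, hy⟩, _⟩ => hC y R hy)
    fun R ⟨⟨y, hy⟩, _⟩ => B.volume_pos y R hy

end Measurability

theorem upperDeriv_eq_iInf (f : EuclideanSpace ℝ (Fin n) → ℝ) (x : EuclideanSpace ℝ (Fin n)) :
    B.upperDeriv f x = ⨅ k : ℕ, ⨆ R ∈ B.sets x, ⨆ _ : ediam R < ((k : ℝ≥0∞) + 1)⁻¹,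
      ((⨍ y in R, f y : ℝ) : EReal) := by
  have hbasis : (B.shrink x).HasBasis (fun _ : ℕ => True)
      fun k => {R | R ∈ B.sets x ∧ ediam R < ((k : ℝ≥0∞) + 1)⁻¹} := by
    refine (B.hasBasis_shrink x).to_hasBasis (fun ε hε => ?_) fun k _ =>
      ⟨((k : ℝ≥0∞) + 1)⁻¹, by simp, subset_rfl⟩
    obtain ⟨k, hk⟩ := ENNReal.exists_inv_nat_lt hε.ne'
    refine ⟨k, trivial, fun R hR => ⟨hR.1, hR.2.trans (lt_of_le_of_lt ?_ hk)⟩⟩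
    exact ENNReal.inv_le_inv.2 le_self_add
  rw [upperDeriv, hbasis.limsup_eq_iInf_iSup]
  simp only [mem_ofPred_eq, iSup_and, iInf_pos]

theorem lowerDeriv_eq_neg_upperDeriv_neg (f : EuclideanSpace ℝ (Fin n) → ℝ)
    (x : EuclideanSpace ℝ (Fin n)) : B.lowerDeriv f x = -B.upperDeriv (fun y => -f y) x := by
  rw [lowerDeriv, upperDeriv, ← EReal.liminf_neg]
  congr 1
  ext R
  simp only [Pi.neg_apply, setAverage_eq, integral_neg, smul_neg, EReal.coe_neg, neg_neg]

theorem isMeasurable_of_iSup (hmean : ∀ f : EuclideanSpace ℝ (Fin n) → ℝ, Integrable f volume →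
      ∀ r : ℝ≥0∞, NullMeasurable (fun x => ⨆ R ∈ B.sets x, ⨆ _ : ediam R < r,
        ((⨍ y in R, f y : ℝ) : EReal)) volume)
    (hmax : ∀ f : EuclideanSpace ℝ (Fin n) → ℝ, Integrable f volume →
      ∀ r : ℝ≥0∞, NullMeasurable (B.maximal r f) volume) : B.IsMeasurable := by
  have hup : ∀ f : EuclideanSpace ℝ (Fin n) → ℝ, Integrable f volume →
      NullMeasurable (B.upperDeriv f) volume := by
    intro f hf
    rw [funext (upperDeriv_eq_iInf f)]
    exact Measurable.iInf (δ := NullMeasurableSpace (EuclideanSpace ℝ (Fin n)) volume)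
      fun k : ℕ => hmean f hf _
  refine fun f hf => ⟨hup f hf, ?_, fun r _ => hmax f hf r⟩
  rw [funext (lowerDeriv_eq_neg_upperDeriv_neg f)]
  exact continuous_neg.measurable.comp (hup _ hf.neg).measurable'

theorem isMeasurable (hT : B.IsTranslationInvariant) (hC : B.IsConvex) : B.IsMeasurable := by
  refine isMeasurable_of_iSup (fun f hf r => ?_) fun f hf r => ?_
  · refine nullMeasurable_iSup_of_continuous hT (fun x R hR => ?_) r
    simp_rw [setAverage_eq, measureReal_def, measure_vadd]
    have := (hC x R hR).continuous_setIntegral_vadd hf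
    exact continuous_coe_real_ereal.comp (by fun_prop)
  · refine nullMeasurable_iSup_of_continuous hT (fun x R hR => ?_) r
    simp_rw [measure_vadd]
    exact (ENNReal.continuous_const_mul (ENNReal.inv_ne_top.2 (B.volume_pos x R hR).ne')).comp
      ((hC x R hR).continuous_setLIntegral_enorm_vadd hf)

theorem isMeasurable_busemannFeller (hC : B.IsConvex) : B.busemannFeller.IsMeasurable :=
  isMeasurable_of_iSup (fun _ _ => nullMeasurable_iSup_busemannFeller hC _)
    fun _ _ => nullMeasurable_iSup_busemannFeller hC _

/-! ### Local majorization in both directions -/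

theorem busemannFeller_locallyMajorizes (hT : B.IsTranslationInvariant) (hC : B.IsConvex) :
    B.busemannFeller.LocallyMajorizes B := by
  refine ⟨isMeasurable hT hC, isMeasurable_busemannFeller hC, 1, 1, le_rfl, one_pos,
    fun f _ r t _ _ _ => ?_⟩
  simp only [ENNReal.coe_one, one_mul, div_one]
  exact measure_mono fun x hx => le_trans hx (maximal_le_busemannFeller _ f x)

theorem locallyMajorizes_busemannFeller (hD : B.IsDensity) (hT : B.IsTranslationInvariant)
    (hC : B.IsConvex) : B.LocallyMajorizes B.busemannFeller := by
  obtain ⟨C, δ, hδ, h⟩ := exists_volume_busemannFeller_maximal_le hD hT hC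
  set N : ℕ := 5 ^ n * 2 ^ (n + 1)
  have hN : 1 ≤ 2 * (N : ℝ≥0) := by
    have : 1 ≤ 2 * N := by have : 0 < N := by positivity
                           omega
    exact_mod_cast this
  set c : ℝ≥0 := max C (2 * N)
  have hc : 1 ≤ c := hN.trans (le_max_right _ _)
  refine ⟨isMeasurable_busemannFeller hC, isMeasurable hT hC, c, δ, hc, hδ,
    fun f _ r t _ hrδ ht => (h f r t hrδ.le ht).trans ?_⟩
  refine mul_le_mul' (ENNReal.coe_le_coe.2 (le_max_left _ _)) (measure_mono ?_)
  · intro x hx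
    refine le_trans ?_ (hx.trans (B.maximal_mono ?_ f x))
    · rw [div_eq_mul_inv ((t : ℝ≥0∞) / 2), div_eq_mul_inv (t : ℝ≥0∞) 2, mul_assoc,
        ← ENNReal.mul_inv (by simp) (by simp), ← div_eq_mul_inv]
      gcongr
      have : 2 * (N : ℝ≥0) ≤ c := le_max_right _ _
      exact_mod_cast this
    · calc (r : ℝ≥0∞) = 1 * r := (one_mul _).symm
        _ ≤ c * r := by gcongr; exact_mod_cast hc
-- From halo bounds back to the density property
theorem volume_setOf_forall_mem_halo {lam C : ℝ≥0} {δ : ℝ≥0∞} (hδ : 0 < δ)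
    (h : ∀ A, MeasurableSet A → volume A ≠ ∞ → volume (B.halo δ lam A) ≤ C * volume A)
    {A : Set (EuclideanSpace ℝ (Fin n))} (hA : MeasurableSet A) (hfin : volume A ≠ ∞) :
    volume {x | x ∉ A ∧ ∀ ε > 0, x ∈ B.halo ε lam A} = 0 := by
  have hle : ∀ η : ℝ≥0, 0 < η → volume {x | x ∉ A ∧ ∀ ε > 0, x ∈ B.halo ε lam A} ≤ C * η := by
    intro η hη
    -- A closed `K ⊆ A` stays at positive distance from `x ∉ A`, so sets of small diameter at `x`
    -- see only `A \ K`, whose halo is as small as desired.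
    obtain ⟨K, hKA, hKc, hK⟩ := hA.exists_isClosed_sdiff_lt hfin (ENNReal.coe_pos.2 hη).ne'
    refine le_trans (measure_mono ?_) ((h (A \ K) (hA.diff hKc.measurableSet)
      (ne_top_of_le_ne_top hfin (measure_mono sdiff_subset))).trans (by gcongr))
    rintro x ⟨hxA, hx⟩
    obtain ⟨ρ, hρ, hball⟩ := Metric.isOpen_iff.1 hKc.isOpen_compl x fun hxK => hxA (hKA hxK)
    obtain ⟨R, hR, hd, hlt⟩ := hx (min δ (ENNReal.ofReal ρ))
      (lt_min hδ (ENNReal.ofReal_pos.2 hρ))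
    refine ⟨R, hR, hd.trans_le (min_le_left _ _), hlt.trans_le (measure_mono fun y hy =>
      ⟨hy.1, hy.2, ?_⟩)⟩
    exact hball (subset_ball_of_ediam_lt (B.mem x R hR) (hd.trans_le (min_le_right _ _)) hy.1)
  refine le_antisymm (ge_of_tendsto (x := 𝓝[>] (0 : ℝ≥0)) (f := fun η : ℝ≥0 => (C : ℝ≥0∞) * η)
    ?_ ?_) zero_le
  · have : Tendsto (fun η : ℝ≥0 => ((C * η : ℝ≥0) : ℝ≥0∞)) (𝓝 0) (𝓝 ((C * 0 : ℝ≥0) : ℝ≥0∞)) :=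
      ENNReal.tendsto_coe.2 ((continuous_const.mul continuous_id).tendsto 0)
    simpa using this.mono_left nhdsWithin_le_nhds
  · filter_upwards [self_mem_nhdsWithin] with η hη using hle η hη

theorem tendsto_average_of_notMem (h : ∀ lam : ℝ≥0, 0 < lam → ∃ C δ : ℝ≥0, 0 < δ ∧
      ∀ A, MeasurableSet A → volume A ≠ ∞ → volume (B.halo δ lam A) ≤ C * volume A)
    {A : Set (EuclideanSpace ℝ (Fin n))} (hA : MeasurableSet A) (hfin : volume A ≠ ∞) :
    ∀ᵐ x, x ∉ A → Tendsto (fun R => ⨍ y in R, A.indicator (fun _ => (1 : ℝ)) y) (B.shrink x)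
      (𝓝 0) := by
  have hk : ∀ᵐ x, ∀ k : ℕ, ¬ (x ∉ A ∧ ∀ ε > 0, x ∈ B.halo ε (1 / ((k : ℝ≥0) + 1)) A) := by
    rw [ae_all_iff]
    intro k
    obtain ⟨C, δ, hδ, hC⟩ := h (1 / ((k : ℝ≥0) + 1)) (by positivity)
    exact measure_eq_zero_iff_ae_notMem.1
      (volume_setOf_forall_mem_halo (ENNReal.coe_pos.2 hδ) hC hA hfin)
  filter_upwards [hk] with x hx hxA
  refine tendsto_order.2 ⟨fun a ha => .of_forall fun R => ha.trans_le ?_, fun a ha => ?_⟩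
  · rw [setAverage_indicator_one hA.nullMeasurableSet]
    positivity
  · obtain ⟨k, hk⟩ := exists_nat_one_div_lt ha
    have := hx k
    push Not at this
    obtain ⟨ε, hε, hxε⟩ := this hxA
    refine (B.hasBasis_shrink x).eventually_iff.2 ⟨ε, hε, fun R hR => lt_of_le_of_lt ?_ hk⟩
    rw [setAverage_indicator_one hA.nullMeasurableSet, measureReal_def, measureReal_def,
      div_le_iff₀ (ENNReal.toReal_pos
      (B.volume_pos x R hR.1).ne' (volume_ne_top hR.1))]
    have hle : volume (R ∩ A) ≤ ((1 / ((k : ℝ≥0) + 1) : ℝ≥0) : ℝ≥0∞) * volume R := by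
      by_contra! hlt
      exact hxε ⟨R, hR.1, hR.2, hlt⟩
    have := ENNReal.toReal_mono (ENNReal.mul_ne_top (by simp) (volume_ne_top hR.1)) hle
    rw [ENNReal.toReal_mul, ENNReal.coe_toReal] at this
    exact_mod_cast this

/-- Outside `E` the means tend to 0. At points of `E` the same applies to the complement of `E` in a
large ball, and the two means add up to 1 once the sets lie in that ball. -/
theorem isDensity_of_volume_halo_le (h : ∀ lam : ℝ≥0, 0 < lam → ∃ C δ : ℝ≥0, 0 < δ ∧
      ∀ A, MeasurableSet A → volume A ≠ ∞ → volume (B.halo δ lam A) ≤ C * volume A) :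
    B.IsDensity := by
  intro E₀ hb₀ hE₀
  obtain ⟨E, hEsub, hE, hae⟩ := hE₀.exists_measurable_subset_ae_eq
  have hb : Bornology.IsBounded E := hb₀.subset hEsub
  have hfin : volume E ≠ ∞ := hb.measure_lt_top.ne
  have hmean : ∀ R : Set (EuclideanSpace ℝ (Fin n)),
      ⨍ y in R, E₀.indicator (fun _ => (1 : ℝ)) y = ⨍ y in R, E.indicator (fun _ => (1 : ℝ)) y := by
    intro R
    rw [setAverage_indicator_one hE₀, setAverage_indicator_one hE.nullMeasurableSet,
      measureReal_def (s := R ∩ E), measure_congr ((ae_eq_refl R).inter hae), measureReal_def]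
  have hF : ∀ m : ℕ, MeasurableSet (ball (0 : EuclideanSpace ℝ (Fin n)) m \ E) := fun m =>
    measurableSet_ball.diff hE
  have hFfin : ∀ m : ℕ, volume (ball (0 : EuclideanSpace ℝ (Fin n)) m \ E) ≠ ∞ := fun m =>
    ne_top_of_le_ne_top measure_ball_lt_top.ne (measure_mono sdiff_subset)
  filter_upwards [tendsto_average_of_notMem h hE hfin,
    ae_all_iff.2 fun m : ℕ => tendsto_average_of_notMem h (hF m) (hFfin m), hae.mem_iff]
    with x hxE hxF hx
  have hlim : Tendsto (fun R => ⨍ y in R, E₀.indicator (fun _ => (1 : ℝ)) y) (B.shrink x)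
      (𝓝 (E₀.indicator (fun _ => (1 : ℝ)) x)) := by
    simp_rw [hmean]
    by_cases hxm : x ∈ E
    · rw [indicator_of_mem (hx.1 hxm)]
      obtain ⟨m, hm⟩ := exists_nat_gt ‖x‖
      have hlimF := (hxF m fun hxd => hxd.2 hxm).const_sub 1
      rw [sub_zero] at hlimF
      refine hlimF.congr' ?_
      obtain ⟨ρ, hρ, hball⟩ := Metric.isOpen_iff.1 isOpen_ball x (mem_ball_zero_iff.2 hm)
      refine (B.hasBasis_shrink x).eventually_iff.2 ⟨ENNReal.ofReal ρ, ENNReal.ofReal_pos.2 hρ,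
        fun R hR => ?_⟩
      have hRb := (subset_ball_of_ediam_lt (B.mem x R hR.1) hR.2).trans hball
      have hRT := volume_ne_top hR.1
      have hsum : volume.real (R ∩ E) + volume.real (R ∩ (ball 0 (m : ℝ) \ E)) =
          volume.real R := by
        rw [← measureReal_inter_add_sdiff (s := R) hE hRT]
        congr 2
        ext y
        exact ⟨fun hy => ⟨hy.1, hy.2.2⟩, fun hy => ⟨hy.1, hRb hy.1, hy.2⟩⟩
      have hpos : volume.real R ≠ 0 := (ENNReal.toReal_pos (B.volume_pos x R hR.1).ne' hRT).ne'
      change 1 - ⨍ y in R, (ball 0 (m : ℝ) \ E).indicator (fun _ => (1 : ℝ)) y =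
        ⨍ y in R, E.indicator (fun _ => (1 : ℝ)) y
      rw [setAverage_indicator_one (hF m).nullMeasurableSet,
        setAverage_indicator_one hE.nullMeasurableSet, sub_eq_iff_eq_add, ← add_div, hsum,
        div_self hpos]
    · rw [indicator_of_notMem fun hm => hxm (hx.2 hm)]
      exact hxE hxm
  have hlim' := (continuous_coe_real_ereal.tendsto _).comp hlim
  exact ⟨hlim'.limsup_eq, hlim'.liminf_eq⟩

theorem setLIntegral_enorm_indicator_one {A R : Set (EuclideanSpace ℝ (Fin n))}
    (hA : MeasurableSet A) :
    ∫⁻ y in R, ‖A.indicator (fun _ => (1 : ℝ)) y‖ₑ = volume (R ∩ A) := by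
  simp_rw [enorm_indicator_eq_indicator_enorm, enorm_one]
  rw [lintegral_indicator_const hA, Measure.restrict_apply hA, one_mul, inter_comm]

/-- For the indicator of `A`, a halo is governed by a superlevel set of the maximal function, so the
maximal bound followed by the halo bound for `B` gives a halo bound for the extension. -/
theorem isDensity_busemannFeller (hD : B.IsDensity) (hT : B.IsTranslationInvariant)
    (hC : B.IsConvex) : B.busemannFeller.IsDensity := by
  refine isDensity_of_volume_halo_le fun lam hlam => ?_
  obtain ⟨C₁, δ₁, hδ₁, h₁⟩ := exists_volume_busemannFeller_maximal_le hD hT hC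
  set N : ℕ := 5 ^ n * 2 ^ (n + 1)
  -- `lam / 2 / N` is the level lost in the comparison; the final halving turns a weak inequality
  -- into the strict one that halos require.
  set lam' : ℝ≥0 := lam / 2 / N / 2
  have hN : (0 : ℝ≥0) < N := by simp [N]
  have hlam' : 0 < lam' := by positivity
  obtain ⟨C₂, δ₂, hδ₂, h₂⟩ := hD.exists_volume_halo_le hT hC hlam'
  refine ⟨C₁ * C₂, min δ₁ δ₂, lt_min hδ₁ hδ₂, fun A hA _ => ?_⟩
  have hsub₁ : B.busemannFeller.halo (min δ₁ δ₂ : ℝ≥0) lam A ⊆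
      {x | (lam : ℝ≥0∞) ≤ B.busemannFeller.maximal (min δ₁ δ₂ : ℝ≥0)
        (A.indicator fun _ => 1) x} := by
    rintro x ⟨R, hR, hd, hlt⟩
    exact (lt_maximal_iff.2 ⟨R, hR, hd, by rwa [setLIntegral_enorm_indicator_one hA]⟩).le
  have hsub₂ : {x | (lam : ℝ≥0∞) / 2 / N ≤ B.maximal (min δ₁ δ₂ : ℝ≥0)
      (A.indicator fun _ => 1) x} ⊆ B.halo δ₂ lam' A := by
    intro x hx
    have hlt : (lam' : ℝ≥0∞) < B.maximal (min δ₁ δ₂ : ℝ≥0) (A.indicator fun _ => 1) x := by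
      refine lt_of_lt_of_le ?_ hx
      have : lam' < lam / 2 / N := NNReal.half_lt_self (by positivity)
      have hcoe : ((lam / 2 / N : ℝ≥0) : ℝ≥0∞) = (lam : ℝ≥0∞) / 2 / N := by
        rw [ENNReal.coe_div hN.ne', ENNReal.coe_div two_ne_zero, ENNReal.coe_natCast,
          ENNReal.coe_ofNat]
      exact (ENNReal.coe_lt_coe.2 this).trans_eq hcoe
    obtain ⟨R, hR, hd, hRlt⟩ := lt_maximal_iff.1 hlt
    rw [setLIntegral_enorm_indicator_one hA] at hRlt
    exact ⟨R, hR, hd.trans_le (by exact_mod_cast min_le_right _ _), hRlt⟩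
  calc volume (B.busemannFeller.halo (min δ₁ δ₂ : ℝ≥0) lam A)
      ≤ C₁ * volume {x | (lam : ℝ≥0∞) / 2 / N ≤ B.maximal (min δ₁ δ₂ : ℝ≥0)
          (A.indicator fun _ => 1) x} :=
        (measure_mono hsub₁).trans (h₁ _ _ _ (min_le_left _ _) hlam)
    _ ≤ C₁ * (C₂ * volume A) := by
        gcongr
        exact (measure_mono hsub₂).trans (h₂ A hA)
    _ = ((C₁ * C₂ : ℝ≥0) : ℝ≥0∞) * volume A := by push_cast; ring

end DiffBasis

theorem theorem3 (n : ℕ) (hn : 2 ≤ n) (B : DiffBasis n) (hT : B.IsTranslationInvariant)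
    (hC : B.IsConvex) (hD : B.IsDensity) :
    B.busemannFeller.IsDensity ∧ B.busemannFeller.LocallyMajorizes B ∧
      B.LocallyMajorizes B.busemannFeller :=
  ⟨B.isDensity_busemannFeller hD hT hC, B.busemannFeller_locallyMajorizes hT hC,
    B.locallyMajorizes_busemannFeller hD hT hC⟩
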